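/- For a monoid $M$, the family $\operatorname{Rat}(M)$ of rational subsets of $M$ is the smallest family of subsets of $M$ that contains all finite subsets and is closed under $L_1\cup L_2$, $L_1\cdot L_2$ and the Kleene star $L^*$ (the submonoid generated by $L$). For a submonoid $N\leq M$, a subset of $M$ is called flat rational over $N$ if it is a finite union of sets of the form $L_0g_1L_1\cdots g_tL_t$ with $t\geq 0$, $L_i\in\operatorname{Rat}(N)$ and $g_i\in M$. A finite Boolean combination of such sets is a set obtained from them by finitely many unions, intersections and complements in $M$; it is described by a Boolean expression whose atoms are flat rational expressions, in which the $L_i$ are given by rational expressions over $N$ (finite sets being given as lists of elements). Then the following holds for $M=\mathrm{GL}(2,\mathbb{Q})$ and $N=\mathrm{GL}(2,\mathbb{Z})$, where matrices are given by their entries and rational numbers by numerator and denominator. The finite Boolean combinations of flat rational subsets of $\mathrm{GL}(2,\mathbb{Q})$ over $\mathrm{GL}(2,\mathbb{Z})$ are exactly the sets described by such Boolean expressions, and there is an algorithm that, given such a Boolean expression, decides whether the set $B\subseteq\mathrm{GL}(2,\mathbb{Q})$ that it describes is empty. -/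

import Mathlib

namespace FlatRational

section Sets

open scoped Pointwise

/-- The family of rational subsets of a monoid `M`: the least family that contains the finite
subsets and is closed under union, product and Kleene star (the generated submonoid). -/
inductive IsRational {M : Type*} [Monoid M] : Set M → Prop
  | finite (L : Set M) : L.Finite → IsRational L
  | union (L₁ L₂ : Set M) : IsRational L₁ → IsRational L₂ → IsRational (L₁ ∪ L₂)
  | mul (L₁ L₂ : Set M) : IsRational L₁ → IsRational L₂ → IsRational (L₁ * L₂)
  | star (L : Set M) : IsRational L → IsRational (Submonoid.closure L : Set M)

/-- The sets `L₀ g₁ L₁ ⋯ gₜ Lₜ` with `t ≥ 0`, every `Lᵢ` a rational subset of the submonoid `N`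
and every `gᵢ` an element of `M`. -/
inductive IsFlatProduct {M : Type*} [Monoid M] (N : Submonoid M) : Set M → Prop
  | base (L : Set N) : IsRational L → IsFlatProduct N ((↑) '' L)
  | snoc (P : Set M) (g : M) (L : Set N) : IsFlatProduct N P → IsRational L →
      IsFlatProduct N (P * {g} * ((↑) '' L))

/-- `L` is a flat rational subset of `M` over `N`: a finite union of sets
`L₀ g₁ L₁ ⋯ gₜ Lₜ`. -/
def IsFlatRational {M : Type*} [Monoid M] (N : Submonoid M) (L : Set M) : Prop :=
  ∃ S : Set (Set M), S.Finite ∧ (∀ P ∈ S, IsFlatProduct N P) ∧ L = ⋃₀ S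

end Sets

section Expressions

open scoped Pointwise

/-- Rational expressions over a monoid `M`; the finite sets are given by lists. -/
inductive RatExpr (M : Type*)
  | finite (l : List M)
  | union (e₁ e₂ : RatExpr M)
  | mul (e₁ e₂ : RatExpr M)
  | star (e : RatExpr M)

/-- The rational set described by a rational expression. -/
def RatExpr.eval {M : Type*} [Monoid M] : RatExpr M → Set M
  | .finite l => {x | x ∈ l}
  | .union e₁ e₂ => e₁.eval ∪ e₂.eval
  | .mul e₁ e₂ => e₁.eval * e₂.eval
  | .star e => (Submonoid.closure e.eval : Set M)

/-- Formal products `e₀ g₁ e₁ ⋯ gₜ eₜ`. -/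
inductive FlatTerm {M : Type*} [Monoid M] (N : Submonoid M)
  | base (e : RatExpr N)
  | snoc (p : FlatTerm N) (g : M) (e : RatExpr N)

/-- The set described by a formal product. -/
def FlatTerm.eval {M : Type*} [Monoid M] {N : Submonoid M} : FlatTerm N → Set M
  | .base e => (↑) '' e.eval
  | .snoc p g e => p.eval * {g} * ((↑) '' e.eval)

/-- Boolean expressions over flat rational expressions. A flat rational expression is a finite
list of formal products, read as their union. Complements are taken in `M`. -/
inductive BoolExpr {M : Type*} [Monoid M] (N : Submonoid M)
  | flat (l : List (FlatTerm N))
  | union (b₁ b₂ : BoolExpr N)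
  | inter (b₁ b₂ : BoolExpr N)
  | compl (b : BoolExpr N)

/-- The subset of `M` described by a Boolean expression. -/
def BoolExpr.eval {M : Type*} [Monoid M] {N : Submonoid M} : BoolExpr N → Set M
  | .flat l => {x | ∃ t ∈ l, x ∈ t.eval}
  | .union b₁ b₂ => b₁.eval ∪ b₂.eval
  | .inter b₁ b₂ => b₁.eval ∩ b₂.eval
  | .compl b => b.evalᶜ

end Expressions

section Coding

/-- The code of a rational expression, given a coding `c` of the monoid elements. -/
def RatExpr.code {M : Type*} (c : M → ℕ) : RatExpr M → ℕ
  | .finite l => Nat.pair 0 (Encodable.encode (l.map c))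
  | .union e₁ e₂ => Nat.pair 1 (Nat.pair (e₁.code c) (e₂.code c))
  | .mul e₁ e₂ => Nat.pair 2 (Nat.pair (e₁.code c) (e₂.code c))
  | .star e => Nat.pair 3 (e.code c)

/-- The code of a formal product, given a coding `c` of the elements of `M`. -/
def FlatTerm.code {M : Type*} [Monoid M] {N : Submonoid M} (c : M → ℕ) : FlatTerm N → ℕ
  | .base e => Nat.pair 0 (e.code fun h : N => c h)
  | .snoc p g e => Nat.pair 1 (Nat.pair (p.code c) (Nat.pair (c g) (e.code fun h : N => c h)))

/-- The code of a Boolean expression, given a coding `c` of the elements of `M`. -/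
def BoolExpr.code {M : Type*} [Monoid M] {N : Submonoid M} (c : M → ℕ) : BoolExpr N → ℕ
  | .flat l => Nat.pair 0 (Encodable.encode (l.map (FlatTerm.code c)))
  | .union b₁ b₂ => Nat.pair 1 (Nat.pair (b₁.code c) (b₂.code c))
  | .inter b₁ b₂ => Nat.pair 2 (Nat.pair (b₁.code c) (b₂.code c))
  | .compl b => Nat.pair 3 (b.code c)

/-- A rational number is coded by its numerator and denominator in lowest terms. -/
def ratCode (q : ℚ) : ℕ := Nat.pair (Equiv.intEquivNat q.num) q.den

/-- An invertible rational matrix is coded by its four entries. -/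
def matCode (g : GL (Fin 2) ℚ) : ℕ :=
  Nat.pair (Nat.pair (ratCode (g.val 0 0)) (ratCode (g.val 0 1)))
    (Nat.pair (ratCode (g.val 1 0)) (ratCode (g.val 1 1)))

end Coding

/-- `GL(2,ℤ)` as a submonoid of `GL(2,ℚ)`: the image under the entrywise inclusion. -/
def GL2Z : Submonoid (GL (Fin 2) ℚ) :=
  (Matrix.GeneralLinearGroup.map (n := Fin 2) (Int.castRingHom ℚ)).range.toSubmonoid

end FlatRational

/-!
Sanov's theorem makes the two matrices `!![1, 2; 0, 1]` and `!![1, 0; 2, 1]` generate a free group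
`F`; it has finite index in `GL(2,ℤ)`, infinite index in `GL(2,ℚ)`, and decidable membership. Every
`g ∈ GL(2,ℚ)` commensurates `GL(2,ℤ)`, so `g * GL(2,ℤ)` meets only finitely many right cosets of
`F`, and therefore so do all flat products and all their prefixes. Thus an automaton for a flat
product, whose labels are matrices, becomes an automaton over `F` once its states are paired with
coset representatives.

To such an automaton Benois' saturation adds all transitions that arise by cancelling inverse
letters; it then reads an element of `F` exactly if it reads the reduced word. Running all atoms of
a Boolean expression simultaneously on the reduced words, as in the subset construction, lists the
truth values that the atoms take on the cosets in question. Off these cosets all atoms are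
false, and such elements exist because the index is infinite. A certificate is a guess of coset
representatives together with bounds for the saturation and the exploration. Its validity is a
primitive recursive condition, and every expression has a valid one, so unbounded search finds it.
-/

namespace FlatRational

section PrimrecTools

variable {α β : Type*} [Primcodable α] [Primcodable β]

theorem primrecPred_exists_mem {f : α → List β} {p : α → β → Prop} (hf : Primrec f)
    (hp : PrimrecRel p) : PrimrecPred fun a => ∃ b ∈ f a, p a b :=
  (PrimrecRel.exists_mem_list hp.swap).comp hf Primrec.id

theorem primrecPred_forall_mem {f : α → List β} {p : α → β → Prop} (hf : Primrec f)
    (hp : PrimrecRel p) : PrimrecPred fun a => ∀ b ∈ f a, p a b :=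
  (PrimrecRel.forall_mem_list hp.swap).comp hf Primrec.id

theorem primrecPred_mem {f : α → List β} {g : α → β} (hf : Primrec f) (hg : Primrec g) :
    PrimrecPred fun a => g a ∈ f a :=
  (primrecPred_exists_mem (p := fun a b => b = g a) hf
    (Primrec.eq.comp Primrec.snd (hg.comp Primrec.fst))).of_eq fun a => by simp

theorem primrecPred_imp {p q : α → Prop} (hp : PrimrecPred p) (hq : PrimrecPred q) :
    PrimrecPred fun a => p a → q a :=
  (hp.not.or hq).of_eq fun _ => imp_iff_not_or.symm

theorem primrec_filter {f : α → List β} {p : α → β → Prop} [∀ a, DecidablePred (p a)]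
    (hf : Primrec f) (hp : PrimrecRel p) : Primrec fun a => (f a).filter fun b => p a b := by
  classical
  refine ((PrimrecRel.listFilter hp.swap).comp hf Primrec.id).of_eq fun a => ?_
  exact List.filter_congr fun x _ => by simp only [Function.swap, id]

/-- The coding structure induced by an injective code with primitive recursive range. -/
noncomputable abbrev primcodableOfCode {X : Type*} (c : X → ℕ) (hc : Function.Injective c)
    (h : PrimrecPred (· ∈ Set.range c)) : Primcodable X :=
  letI := Classical.decPred (· ∈ Set.range c)
  letI := Primcodable.subtype h
  Primcodable.ofEquiv (Set.range c) (Equiv.ofInjective c hc)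

end PrimrecTools

section Gcd

theorem gcd_eq_findGreatest (a b : ℕ) :
    a.gcd b = Nat.findGreatest (fun k => k ∣ a ∧ k ∣ b) (a + b) := by
  rcases Nat.eq_zero_or_pos (a + b) with hab | hab
  · obtain ⟨rfl, rfl⟩ : a = 0 ∧ b = 0 := by omega
    rfl
  have hle : a.gcd b ≤ a + b := by
    rcases Nat.eq_zero_or_pos a with rfl | ha
    · simp
    · exact (Nat.gcd_le_left b ha).trans (Nat.le_add_right a b)
  have hdvd : a.gcd b ∣ a ∧ a.gcd b ∣ b := ⟨Nat.gcd_dvd_left a b, Nat.gcd_dvd_right a b⟩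
  have hmax := Nat.findGreatest_spec (P := fun k => k ∣ a ∧ k ∣ b) hle hdvd
  exact le_antisymm (Nat.le_findGreatest hle hdvd)
    (Nat.le_of_dvd (Nat.gcd_pos_iff.2 (by omega)) (Nat.dvd_gcd hmax.1 hmax.2))

theorem primrec_gcd : Primrec₂ Nat.gcd := by
  have hdvd {f g : (ℕ × ℕ) × ℕ → ℕ} (hf : Primrec f) (hg : Primrec g) :
      PrimrecPred fun x => f x ∣ g x :=
    (Primrec.eq.comp (Primrec.nat_mod.comp hg hf) (Primrec.const 0)).of_eq fun x =>
      (Nat.dvd_iff_mod_eq_zero (m := f x)).symm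
  refine (Primrec.nat_findGreatest (f := fun x : ℕ × ℕ => x.1 + x.2)
    (p := fun x k => k ∣ x.1 ∧ k ∣ x.2) (Primrec.nat_add.comp Primrec.fst Primrec.snd)
    ((hdvd Primrec.snd (Primrec.fst.comp Primrec.fst)).and
      (hdvd Primrec.snd (Primrec.snd.comp Primrec.fst)))).of_eq fun x => ?_
  exact (gcd_eq_findGreatest x.1 x.2).symm

end Gcd

section IntegerCoding

/-- The coding of the integers by `Equiv.intEquivNat`. -/
abbrev intPrimcodable : Primcodable ℤ := Primcodable.ofEquiv ℕ Equiv.intEquivNat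

attribute [local instance] intPrimcodable

variable {α : Type*} [Primcodable α]

theorem intEquivNat_natCast (k : ℕ) : Equiv.intEquivNat (k : ℤ) = 2 * k := rfl

theorem intEquivNat_negSucc (k : ℕ) : Equiv.intEquivNat (Int.negSucc k) = 2 * k + 1 := rfl

theorem toNat_eq_ite_intEquivNat (z : ℤ) : z.toNat =
    if Equiv.intEquivNat z % 2 = 0 then Equiv.intEquivNat z / 2 else 0 := by
  rcases z with k | k
  · rw [Int.ofNat_eq_natCast, intEquivNat_natCast]
    simp
  · rw [intEquivNat_negSucc, if_neg (by omega)]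
    rfl

theorem toNat_neg_eq_ite_intEquivNat (z : ℤ) : (-z).toNat =
    if Equiv.intEquivNat z % 2 = 0 then 0 else Equiv.intEquivNat z / 2 + 1 := by
  rcases z with k | k
  · rw [Int.ofNat_eq_natCast, intEquivNat_natCast]
    simp
  · rw [intEquivNat_negSucc, if_neg (by omega), Int.neg_negSucc, Int.toNat_natCast]
    omega

theorem intEquivNat_sub (p n : ℕ) : Equiv.intEquivNat ((p : ℤ) - n) =
    if n ≤ p then 2 * (p - n) else 2 * (n - p) - 1 := by
  split_ifs with h
  · rw [← Nat.cast_sub h, intEquivNat_natCast]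
  · rw [show (p : ℤ) - n = Int.negSucc (n - p - 1) by omega, intEquivNat_negSucc]
    omega

theorem primrec_intEquivNat : Primrec Equiv.intEquivNat := Primrec.encode (α := ℤ)

theorem primrec_toNat : Primrec Int.toNat :=
  (Primrec.ite (Primrec.eq.comp (Primrec.nat_mod.comp primrec_intEquivNat (Primrec.const 2))
    (Primrec.const 0)) (Primrec.nat_div.comp primrec_intEquivNat (Primrec.const 2))
    (Primrec.const 0)).of_eq fun z => (toNat_eq_ite_intEquivNat z).symm

theorem primrec_toNat_neg : Primrec fun z : ℤ => (-z).toNat :=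
  (Primrec.ite (Primrec.eq.comp (Primrec.nat_mod.comp primrec_intEquivNat (Primrec.const 2))
    (Primrec.const 0)) (Primrec.const 0)
    (Primrec.succ.comp (Primrec.nat_div.comp primrec_intEquivNat (Primrec.const 2)))).of_eq
    fun z => (toNat_neg_eq_ite_intEquivNat z).symm

theorem primrec_natCast_sub_natCast : Primrec₂ fun p n : ℕ => (p : ℤ) - n := by
  have hp : Primrec fun x : ℕ × ℕ => x.1 := Primrec.fst
  have hn : Primrec fun x : ℕ × ℕ => x.2 := Primrec.snd
  refine (Primrec.encode_iff (α := ℕ × ℕ) (σ := ℤ)).1 (Primrec.of_eq ?_ fun x =>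
    (intEquivNat_sub x.1 x.2).symm)
  exact Primrec.ite (Primrec.nat_le.comp hn hp)
    (Primrec.nat_mul.comp (Primrec.const 2) (Primrec.nat_sub.comp hp hn))
    (Primrec.nat_sub.comp (Primrec.nat_mul.comp (Primrec.const 2) (Primrec.nat_sub.comp hn hp))
      (Primrec.const 1))

/-- Integer operations are computed on the representation of an integer as a difference of two
natural numbers. -/
theorem primrec_of_eq_sub {f : α → ℤ} {p n : α → ℕ} (hp : Primrec p) (hn : Primrec n)
    (hf : ∀ a, f a = p a - n a) : Primrec f :=
  (primrec_natCast_sub_natCast.comp hp hn).of_eq fun a => (hf a).symm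

theorem primrec_natCast_int : Primrec fun n : ℕ => (n : ℤ) :=
  primrec_of_eq_sub Primrec.id (Primrec.const 0) fun n => by simp

theorem primrec_int_neg : Primrec fun z : ℤ => -z :=
  primrec_of_eq_sub primrec_toNat_neg primrec_toNat fun z => by omega

theorem primrec_int_add : Primrec₂ fun y z : ℤ => y + z :=
  primrec_of_eq_sub
    (Primrec.nat_add.comp (primrec_toNat.comp Primrec.fst) (primrec_toNat.comp Primrec.snd))
    (Primrec.nat_add.comp (primrec_toNat_neg.comp Primrec.fst)
      (primrec_toNat_neg.comp Primrec.snd)) fun x => by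
    dsimp only
    omega

theorem primrec_int_mul : Primrec₂ fun y z : ℤ => y * z := by
  have p₁ : Primrec fun x : ℤ × ℤ => x.1.toNat := primrec_toNat.comp Primrec.fst
  have p₂ : Primrec fun x : ℤ × ℤ => x.2.toNat := primrec_toNat.comp Primrec.snd
  have n₁ : Primrec fun x : ℤ × ℤ => (-x.1).toNat := primrec_toNat_neg.comp Primrec.fst
  have n₂ : Primrec fun x : ℤ × ℤ => (-x.2).toNat := primrec_toNat_neg.comp Primrec.snd
  refine primrec_of_eq_sub
    (Primrec.nat_add.comp (Primrec.nat_mul.comp p₁ p₂) (Primrec.nat_mul.comp n₁ n₂))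
    (Primrec.nat_add.comp (Primrec.nat_mul.comp p₁ n₂) (Primrec.nat_mul.comp n₁ p₂)) fun x => ?_
  conv_lhs => rw [← Int.toNat_sub_toNat_neg x.1, ← Int.toNat_sub_toNat_neg x.2]
  push_cast
  ring

theorem primrec_natAbs : Primrec Int.natAbs :=
  (Primrec.nat_add.comp primrec_toNat primrec_toNat_neg).of_eq fun z => by omega

end IntegerCoding

section RationalCoding

attribute [local instance] intPrimcodable

theorem ratCode_injective : Function.Injective ratCode := by
  intro p q h
  simp only [ratCode, Nat.pair_eq_pair, EmbeddingLike.apply_eq_iff_eq] at h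
  exact Rat.ext h.1 h.2

theorem mem_range_ratCode (n : ℕ) : n ∈ Set.range ratCode ↔ n.unpair.2 ≠ 0 ∧
    (Equiv.intEquivNat.symm n.unpair.1).natAbs.gcd n.unpair.2 = 1 := by
  constructor
  · rintro ⟨q, rfl⟩
    simpa [ratCode] using q.reduced
  · rintro ⟨hden, hcop⟩
    exact ⟨⟨_, n.unpair.2, hden, hcop⟩, by simp [ratCode]⟩

theorem primrecPred_mem_range_ratCode : PrimrecPred (· ∈ Set.range ratCode) := by
  refine PrimrecPred.of_eq ?_ fun n => (mem_range_ratCode n).symm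
  have hden : Primrec fun n : ℕ => n.unpair.2 := Primrec.snd.comp Primrec.unpair
  have hnum : Primrec fun n : ℕ => Equiv.intEquivNat.symm n.unpair.1 :=
    (Primrec.of_equiv_symm (β := ℤ) (e := Equiv.intEquivNat)).comp
      (Primrec.fst.comp Primrec.unpair)
  exact (Primrec.eq.comp hden (Primrec.const 0)).not.and
    (Primrec.eq.comp (primrec_gcd.comp (primrec_natAbs.comp hnum) hden) (Primrec.const 1))

/-- The coding of the rational numbers by `ratCode`. -/
noncomputable abbrev ratPrimcodable : Primcodable ℚ :=
  primcodableOfCode ratCode ratCode_injective primrecPred_mem_range_ratCode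

attribute [local instance] ratPrimcodable

theorem primrec_ratCode : Primrec ratCode := Primrec.encode (α := ℚ)

theorem primrec_den : Primrec Rat.den :=
  (Primrec.snd.comp (Primrec.unpair.comp primrec_ratCode)).of_eq fun q => by simp [ratCode]

theorem primrec_num : Primrec Rat.num :=
  ((Primrec.of_equiv_symm (β := ℤ) (e := Equiv.intEquivNat)).comp
    (Primrec.fst.comp (Primrec.unpair.comp primrec_ratCode))).of_eq fun q => by simp [ratCode]

theorem primrec_of_num_den {α : Type*} [Primcodable α] {f : α → ℚ}
    (hnum : Primrec fun a => (f a).num) (hden : Primrec fun a => (f a).den) : Primrec f :=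
  Primrec.encode_iff.1 (Primrec₂.natPair.comp (primrec_intEquivNat.comp hnum) hden)

theorem num_mkRat_eq_sub (z : ℤ) (d : ℕ) : (mkRat z d).num = if d = 0 then 0 else
    ((z.toNat / d.gcd z.natAbs : ℕ) : ℤ) - ((-z).toNat / d.gcd z.natAbs : ℕ) := by
  rw [Rat.num_mkRat]
  refine if_congr Iff.rfl rfl ?_
  rcases Int.eq_nat_or_neg z with ⟨k, rfl | rfl⟩
  · simp
  · simp only [Int.natAbs_neg, Int.natAbs_natCast, neg_neg, Int.toNat_natCast,
      Int.toNat_neg_natCast, Nat.zero_div, Nat.cast_zero, zero_sub]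
    rw [Int.neg_ediv_of_dvd (Int.natCast_dvd_natCast.2 (Nat.gcd_dvd_right d k)), Int.natCast_div]

theorem primrec_mkRat : Primrec₂ mkRat := by
  have hz : Primrec fun x : ℤ × ℕ => x.1 := Primrec.fst
  have hd : Primrec fun x : ℤ × ℕ => x.2 := Primrec.snd
  have hgcd := primrec_gcd.comp hd (primrec_natAbs.comp hz)
  have hzero : PrimrecPred fun x : ℤ × ℕ => x.2 = 0 := Primrec.eq.comp hd (Primrec.const 0)
  refine primrec_of_num_den ?_ ?_
  · refine (Primrec.ite hzero (Primrec.const 0) (primrec_natCast_sub_natCast.comp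
      (Primrec.nat_div.comp (primrec_toNat.comp hz) hgcd)
      (Primrec.nat_div.comp (primrec_toNat_neg.comp hz) hgcd))).of_eq fun x => ?_
    exact (num_mkRat_eq_sub x.1 x.2).symm
  · refine (Primrec.ite hzero (Primrec.const 1) (Primrec.nat_div.comp hd hgcd)).of_eq fun x => ?_
    exact (Rat.den_mkRat x.1 x.2).symm

theorem primrec_rat_neg : Primrec fun q : ℚ => -q :=
  primrec_of_num_den (primrec_int_neg.comp primrec_num) primrec_den

theorem primrec_rat_mul : Primrec₂ fun q r : ℚ => q * r :=
  (primrec_mkRat.comp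
    (primrec_int_mul.comp (primrec_num.comp Primrec.fst) (primrec_num.comp Primrec.snd))
    (Primrec.nat_mul.comp (primrec_den.comp Primrec.fst) (primrec_den.comp Primrec.snd))).of_eq
    fun x => (Rat.mul_eq_mkRat x.1 x.2).symm

theorem primrec_rat_add : Primrec₂ fun q r : ℚ => q + r := by
  have num₁ : Primrec fun x : ℚ × ℚ => x.1.num := primrec_num.comp Primrec.fst
  have num₂ : Primrec fun x : ℚ × ℚ => x.2.num := primrec_num.comp Primrec.snd
  have den₁ : Primrec fun x : ℚ × ℚ => x.1.den := primrec_den.comp Primrec.fst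
  have den₂ : Primrec fun x : ℚ × ℚ => x.2.den := primrec_den.comp Primrec.snd
  refine (primrec_mkRat.comp (primrec_int_add.comp
    (primrec_int_mul.comp num₁ (primrec_natCast_int.comp den₂))
    (primrec_int_mul.comp num₂ (primrec_natCast_int.comp den₁)))
    (Primrec.nat_mul.comp den₁ den₂)).of_eq fun x => ?_
  exact (Rat.add_def' x.1 x.2).symm

theorem inv_eq_mkRat (q : ℚ) : q⁻¹ = mkRat (if 0 ≤ q then q.den else -q.den) q.num.natAbs := by
  rw [Rat.mkRat_eq_div, Rat.inv_def, Rat.divInt_eq_div]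
  split_ifs with h
  · rw [Nat.cast_natAbs, abs_of_nonneg (Rat.num_nonneg.2 h)]
  · rw [Nat.cast_natAbs, abs_of_neg (Rat.num_neg.2 (not_le.1 h))]
    push_cast
    rw [neg_div_neg_eq]

theorem primrec_rat_inv : Primrec fun q : ℚ => q⁻¹ := by
  have hden := primrec_natCast_int.comp primrec_den
  have hpos : PrimrecPred fun q : ℚ => 0 ≤ q :=
    (Primrec.eq.comp (primrec_toNat_neg.comp primrec_num) (Primrec.const 0)).of_eq fun q => by
      rw [← Rat.num_nonneg]
      omega
  exact (primrec_mkRat.comp (Primrec.ite hpos hden (primrec_int_neg.comp hden))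
    (primrec_natAbs.comp primrec_num)).of_eq fun q => (inv_eq_mkRat q).symm

end RationalCoding

section TreeRecursion

theorem unpair_snd_lt {n : ℕ} (h : n.unpair.1 ≠ 0) : n.unpair.2 < n := by
  conv_rhs => rw [← Nat.pair_unpair n]
  generalize n.unpair.1 = a at *
  generalize n.unpair.2 = b
  unfold Nat.pair
  split_ifs <;> nlinarith [Nat.pos_of_ne_zero h]

variable {σ : Type*} (base : ℕ → σ) (step : ℕ → ℕ → σ → σ → σ → σ)

/-- Recursion over codes of trees: a code `pair 0 m` is a leaf with content `m`, while a code
`pair (t + 1) m` is a node with label `t + 1`. Depending on the label, the children of a node are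
coded by `m` itself or by the two components of `m`; the values at all three are available. -/
def treeRec (n : ℕ) : σ :=
  if h : n.unpair.1 = 0 then base n.unpair.2
  else
    have := unpair_snd_lt h
    have := Nat.unpair_left_le n.unpair.2
    have := Nat.unpair_right_le n.unpair.2
    step n.unpair.1 n.unpair.2 (treeRec n.unpair.2)
      (treeRec n.unpair.2.unpair.1) (treeRec n.unpair.2.unpair.2)
termination_by n

theorem treeRec_leaf (m : ℕ) : treeRec base step (Nat.pair 0 m) = base m := by
  rw [treeRec]
  simp

theorem treeRec_node (t m : ℕ) : treeRec base step (Nat.pair (t + 1) m) =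
    step (t + 1) m (treeRec base step m) (treeRec base step m.unpair.1)
      (treeRec base step m.unpair.2) := by
  rw [treeRec]
  simp

variable {base step} in
theorem treeRec_induction {P : ℕ → σ → Prop} (leaf : ∀ m, P (Nat.pair 0 m) (base m))
    (node : ∀ t m x y z, P m x → P m.unpair.1 y → P m.unpair.2 z →
      P (Nat.pair (t + 1) m) (step (t + 1) m x y z)) (n : ℕ) : P n (treeRec base step n) := by
  induction n using Nat.strong_induction_on with
  | _ n ih =>
    rw [← Nat.pair_unpair n]
    rcases h : n.unpair.1 with _ | t
    · rw [treeRec_leaf]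
      exact leaf _
    · have hlt : n.unpair.2 < n := unpair_snd_lt (by omega)
      rw [treeRec_node]
      exact node _ _ _ _ _ (ih _ hlt) (ih _ ((Nat.unpair_left_le _).trans_lt hlt))
        (ih _ ((Nat.unpair_right_le _).trans_lt hlt))

/-- The next value of `treeRec base step`, computed from the list of all previous values. -/
def treeRecNext [Inhabited σ] (L : List σ) : σ :=
  if L.length.unpair.1 = 0 then base L.length.unpair.2
  else step L.length.unpair.1 L.length.unpair.2 (L.getD L.length.unpair.2 default)
    (L.getD L.length.unpair.2.unpair.1 default) (L.getD L.length.unpair.2.unpair.2 default)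

theorem treeRecNext_map_range [Inhabited σ] (n : ℕ) :
    treeRecNext base step ((List.range n).map (treeRec base step)) = treeRec base step n := by
  have hget {k : ℕ} (hk : k < n) :
      ((List.range n).map (treeRec base step)).getD k default = treeRec base step k := by
    simp [List.getD_eq_getElem?_getD, hk]
  rw [treeRecNext, treeRec, List.length_map, List.length_range]
  split_ifs with h
  · rfl
  · have hlt := unpair_snd_lt h
    rw [hget hlt, hget ((Nat.unpair_left_le _).trans_lt hlt),
      hget ((Nat.unpair_right_le _).trans_lt hlt)]

theorem primrec_treeRec {α σ : Type*} [Primcodable α] [Primcodable σ] [Inhabited σ]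
    {base : α → ℕ → σ} {step : α → ℕ → ℕ → σ → σ → σ → σ} (hbase : Primrec₂ base)
    (hstep : Primrec fun x : α × (ℕ × ℕ) × σ × σ × σ =>
      step x.1 x.2.1.1 x.2.1.2 x.2.2.1 x.2.2.2.1 x.2.2.2.2) :
    Primrec₂ fun a n => treeRec (base a) (step a) n := by
  have code : Primrec fun x : α × List σ => x.2.length.unpair :=
    Primrec.unpair.comp (Primrec.list_length.comp Primrec.snd)
  have label := Primrec.fst.comp code
  have content := Primrec.snd.comp code
  have hget {k : α × List σ → ℕ} (hk : Primrec k) :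
      Primrec fun x : α × List σ => x.2.getD (k x) default :=
    (Primrec.list_getD default).comp Primrec.snd hk
  have hnext : Primrec₂ fun a L => treeRecNext (base a) (step a) L :=
    Primrec.ite (Primrec.eq.comp label (Primrec.const 0)) (hbase.comp Primrec.fst content)
      (hstep.comp (Primrec.fst.pair ((label.pair content).pair ((hget content).pair
        ((hget (Primrec.fst.comp (Primrec.unpair.comp content))).pair
          (hget (Primrec.snd.comp (Primrec.unpair.comp content))))))))
  exact Primrec.nat_strong_rec _ (g := fun a L => some (treeRecNext (base a) (step a) L))
    (Primrec.option_some.comp hnext) fun a n =>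
      congrArg some (treeRecNext_map_range (base a) (step a) n)

end TreeRecursion

section MatrixCoding

attribute [local instance] intPrimcodable ratPrimcodable

theorem primrecPred_det_ne_zero : PrimrecPred fun m : (ℚ × ℚ) × ℚ × ℚ =>
    m.1.1 * m.2.2 ≠ m.1.2 * m.2.1 :=
  (Primrec.eq.comp
    (primrec_rat_mul.comp (Primrec.fst.comp Primrec.fst) (Primrec.snd.comp Primrec.snd))
    (primrec_rat_mul.comp (Primrec.snd.comp Primrec.fst) (Primrec.fst.comp Primrec.snd))).not

/-- An invertible matrix as the quadruple of its entries. -/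
noncomputable def glEquiv :
    GL (Fin 2) ℚ ≃ {m : (ℚ × ℚ) × ℚ × ℚ // m.1.1 * m.2.2 ≠ m.1.2 * m.2.1} where
  toFun g := ⟨((g.val 0 0, g.val 0 1), (g.val 1 0, g.val 1 1)), by
    have h := g.det_ne_zero
    rw [Matrix.det_fin_two] at h
    exact sub_ne_zero.1 h⟩
  invFun m := Matrix.GeneralLinearGroup.mkOfDetNeZero !![m.1.1.1, m.1.1.2; m.1.2.1, m.1.2.2] <| by
    rw [Matrix.det_fin_two_of]
    exact sub_ne_zero.2 m.2
  left_inv g := Units.ext g.val.eta_fin_two.symm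
  right_inv m := rfl

/-- The coding of invertible rational matrices by `matCode`. -/
noncomputable abbrev glPrimcodable : Primcodable (GL (Fin 2) ℚ) :=
  letI := Primcodable.subtype primrecPred_det_ne_zero
  Primcodable.ofEquiv _ glEquiv

attribute [local instance] glPrimcodable

theorem primrec_entry (i j : Fin 2) : Primrec fun g : GL (Fin 2) ℚ => g.val i j := by
  let := Primcodable.subtype primrecPred_det_ne_zero
  have h : Primrec fun g : GL (Fin 2) ℚ => (glEquiv g).val :=
    Primrec.subtype_val.comp (Primrec.of_equiv (e := glEquiv))
  fin_cases i <;> fin_cases j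
  exacts [Primrec.fst.comp (Primrec.fst.comp h), Primrec.snd.comp (Primrec.fst.comp h),
    Primrec.fst.comp (Primrec.snd.comp h), Primrec.snd.comp (Primrec.snd.comp h)]

theorem primrec_of_entry {α : Type*} [Primcodable α] {f : α → GL (Fin 2) ℚ}
    (h : ∀ i j, Primrec fun a => (f a).val i j) : Primrec f := by
  let := Primcodable.subtype primrecPred_det_ne_zero
  exact (Primrec.of_equiv_iff glEquiv).1 (Primrec.subtype_val_iff.1
    (((h 0 0).pair (h 0 1)).pair ((h 1 0).pair (h 1 1))))

theorem primrec_gl_mul : Primrec₂ fun g h : GL (Fin 2) ℚ => g * h :=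
  primrec_of_entry fun i j => by
    refine (primrec_rat_add.comp
      (primrec_rat_mul.comp ((primrec_entry i 0).comp Primrec.fst)
        ((primrec_entry 0 j).comp Primrec.snd))
      (primrec_rat_mul.comp ((primrec_entry i 1).comp Primrec.fst)
        ((primrec_entry 1 j).comp Primrec.snd))).of_eq fun x => ?_
    simp [Matrix.mul_apply, Fin.sum_univ_two]

theorem primrec_gl_det : Primrec fun g : GL (Fin 2) ℚ => g.val.det :=
  (primrec_rat_add.comp (primrec_rat_mul.comp (primrec_entry 0 0) (primrec_entry 1 1))
    (primrec_rat_neg.comp (primrec_rat_mul.comp (primrec_entry 0 1) (primrec_entry 1 0)))).of_eq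
    fun g => by rw [Matrix.det_fin_two, sub_eq_add_neg]

theorem primrec_gl_inv : Primrec fun g : GL (Fin 2) ℚ => g⁻¹ := by
  have hdet := primrec_rat_inv.comp primrec_gl_det
  refine primrec_of_entry fun i j => ?_
  simp only [Matrix.coe_units_inv, Matrix.inv_def, Ring.inverse_eq_inv', Matrix.adjugate_fin_two]
  fin_cases i <;> fin_cases j
  exacts [primrec_rat_mul.comp hdet (primrec_entry 1 1),
    primrec_rat_mul.comp hdet (primrec_rat_neg.comp (primrec_entry 0 1)),
    primrec_rat_mul.comp hdet (primrec_rat_neg.comp (primrec_entry 1 0)),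
    primrec_rat_mul.comp hdet (primrec_entry 0 0)]

theorem mem_GL2Z_iff (g : GL (Fin 2) ℚ) :
    g ∈ GL2Z ↔ ∀ i j, (g.val i j).den = 1 ∧ (g⁻¹.val i j).den = 1 := by
  constructor
  · rintro ⟨h, rfl⟩ i j
    rw [← map_inv]
    exact ⟨Rat.den_intCast (h.val i j), Rat.den_intCast (h⁻¹.val i j)⟩
  · intro h
    have hval : (g.val.map Rat.num).map (Int.castRingHom ℚ) = g.val :=
      Matrix.ext fun i j => Rat.coe_int_num_of_den_eq_one (h i j).1
    have hinv : (g⁻¹.val.map Rat.num).map (Int.castRingHom ℚ) = g⁻¹.val :=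
      Matrix.ext fun i j => Rat.coe_int_num_of_den_eq_one (h i j).2
    have hmap : Function.Injective
        fun m : Matrix (Fin 2) (Fin 2) ℤ => m.map (Int.castRingHom ℚ) :=
      Matrix.map_injective Int.cast_injective
    refine ⟨⟨g.val.map Rat.num, g⁻¹.val.map Rat.num, hmap ?_, hmap ?_⟩, Units.ext hval⟩ <;>
      simp only [Matrix.map_mul, hval, hinv, Units.mul_inv, Units.inv_mul,
        Matrix.map_one _ (map_zero _) (map_one _)]

theorem primrecPred_den_eq_one {α : Type*} [Primcodable α] {f : α → ℚ} (hf : Primrec f) :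
    PrimrecPred fun a => (f a).den = 1 :=
  Primrec.eq.comp (primrec_den.comp hf) (Primrec.const 1)

theorem primrecPred_mem_GL2Z : PrimrecPred (· ∈ GL2Z) := by
  have h (i j : Fin 2) : PrimrecPred fun g : GL (Fin 2) ℚ =>
      (g.val i j).den = 1 ∧ (g⁻¹.val i j).den = 1 :=
    (primrecPred_den_eq_one (primrec_entry i j)).and
      (primrecPred_den_eq_one ((primrec_entry i j).comp primrec_gl_inv))
  refine (((h 0 0).and (h 0 1)).and ((h 1 0).and (h 1 1))).of_eq fun g => ?_
  rw [mem_GL2Z_iff]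
  simp only [Fin.forall_fin_two]

/-- The congruence conditions that cut out the Sanov subgroup. -/
def IsSanov (g : GL (Fin 2) ℚ) : Prop :=
  g.val.det = 1 ∧ ∃ a b c d : ℤ, g.val = !![1 + 4 * (a : ℚ), 2 * b; 2 * c, 1 + 4 * d]

theorem isSanov_iff_den (g : GL (Fin 2) ℚ) : IsSanov g ↔ g.val.det = 1 ∧
    ((g.val 0 0 * (1 / 4) + -1 / 4).den = 1 ∧ (g.val 0 1 * (1 / 2) + 0).den = 1) ∧
      (g.val 1 0 * (1 / 2) + 0).den = 1 ∧ (g.val 1 1 * (1 / 4) + -1 / 4).den = 1 := by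
  have hden (q : ℚ) : q.den = 1 ↔ ∃ z : ℤ, q = z :=
    ⟨fun h => ⟨q.num, (Rat.coe_int_num_of_den_eq_one h).symm⟩,
      fun ⟨z, hz⟩ => hz ▸ Rat.den_intCast z⟩
  simp only [hden]
  refine and_congr_right fun _ => ⟨?_, ?_⟩
  · rintro ⟨a, b, c, d, h⟩
    refine ⟨⟨⟨a, ?_⟩, b, ?_⟩, ⟨c, ?_⟩, d, ?_⟩ <;> rw [h] <;> simp <;> ring
  · rintro ⟨⟨⟨a, ha⟩, b, hb⟩, ⟨c, hc⟩, d, hd⟩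
    refine ⟨a, b, c, d, ?_⟩
    rw [← ha, ← hb, ← hc, ← hd]
    ext i j
    fin_cases i <;> fin_cases j <;> simp <;> ring

theorem primrecPred_isSanov : PrimrecPred IsSanov := by
  have affine (i j : Fin 2) (r s : ℚ) :
      PrimrecPred fun g : GL (Fin 2) ℚ => (g.val i j * r + s).den = 1 :=
    primrecPred_den_eq_one (primrec_rat_add.comp
      (primrec_rat_mul.comp (primrec_entry i j) (Primrec.const r)) (Primrec.const s))
  exact ((Primrec.eq.comp primrec_gl_det (Primrec.const 1)).and
    (((affine 0 0 _ _).and (affine 0 1 _ _)).and ((affine 1 0 _ _).and (affine 1 1 _ _)))).of_eq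
      fun g => (isSanov_iff_den g).symm

end MatrixCoding

section Sanov

/-- The two unipotent generators of the Sanov subgroup. -/
noncomputable def sanovGen (i : Bool) : GL (Fin 2) ℚ :=
  Matrix.GeneralLinearGroup.mkOfDetNeZero (if i then !![1, 2; 0, 1] else !![1, 0; 2, 1])
    (by cases i <;> simp [Matrix.det_fin_two_of])

/-- The homomorphism from the free group of rank two onto the Sanov subgroup. -/
noncomputable def sanov : FreeGroup Bool →* GL (Fin 2) ℚ := FreeGroup.lift sanovGen

theorem sanovGen_val (i : Bool) :
    (sanovGen i).val = if i then !![1, 2; 0, 1] else !![1, 0; 2, 1] := rfl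

theorem sanovGen_inv_val (i : Bool) :
    (sanovGen i)⁻¹.val = if i then !![1, -2; 0, 1] else !![1, 0; -2, 1] := by
  rw [Matrix.coe_units_inv, sanovGen_val]
  cases i <;> simp [Matrix.inv_def, Matrix.adjugate_fin_two_of]

theorem sanovGen_zpow_val (i : Bool) (e : ℤ) :
    (sanovGen i ^ e).val = if i then !![1, 2 * (e : ℚ); 0, 1] else !![1, 0; 2 * (e : ℚ), 1] := by
  induction e using Int.induction_on with
  | zero => cases i <;> simp [Matrix.one_fin_two]
  | succ e ih =>
    rw [zpow_add_one, Units.val_mul, ih, sanovGen_val]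
    cases i <;> simp <;> ring
  | pred e ih =>
    rw [zpow_sub_one, Units.val_mul, ih, sanovGen_inv_val]
    cases i <;> simp <;> ring

theorem sanovGen_zpow_mul_val (i : Bool) (e : ℤ) {g : GL (Fin 2) ℚ} {a b c d : ℚ}
    (hg : g.val = !![a, b; c, d]) : (sanovGen i ^ e * g).val =
      if i then !![a + 2 * e * c, b + 2 * e * d; c, d]
      else !![a, b; 2 * e * a + c, 2 * e * b + d] := by
  rw [Units.val_mul, sanovGen_zpow_val, hg]
  cases i <;> simp

/-- The action of the `e`-th power of a generator of the Sanov subgroup on vectors. -/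
def shear (i : Bool) (e : ℚ) (v : ℚ × ℚ) : ℚ × ℚ :=
  if i then (v.1 + 2 * e * v.2, v.2) else (v.1, 2 * e * v.1 + v.2)

/-- The ping-pong domain that a generator of the Sanov subgroup attracts vectors to. -/
def attractingDomain (i : Bool) : Set (ℚ × ℚ) := {v |
  if i then v.2 * v.2 ≤ v.1 * v.2 else 0 ≤ v.1 * v.2 ∧ v.1 * v.2 < v.2 * v.2}

/-- The ping-pong domain that the inverse of a generator attracts vectors to. -/
def repellingDomain (i : Bool) : Set (ℚ × ℚ) := {v |
  if i then v.1 * v.2 < -(v.2 * v.2) else -(v.2 * v.2) ≤ v.1 * v.2 ∧ v.1 * v.2 < 0}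

theorem mul_self_add_mul_self_pos {v : ℚ × ℚ} (hv : v ≠ 0) : 0 < v.1 * v.1 + v.2 * v.2 := by
  refine lt_of_le_of_ne (add_nonneg (mul_self_nonneg _) (mul_self_nonneg _)) fun h => hv ?_
  exact Prod.ext_iff.2 (mul_self_add_mul_self_eq_zero.1 h.symm)

theorem disjoint_attractingDomain : Disjoint (attractingDomain true) (attractingDomain false) :=
  Set.disjoint_left.2 fun _ h h' => h.not_gt h'.2

theorem disjoint_repellingDomain : Disjoint (repellingDomain true) (repellingDomain false) :=
  Set.disjoint_left.2 fun _ h h' => h.not_ge h'.1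

theorem disjoint_attractingDomain_repellingDomain (i j : Bool) :
    Disjoint (attractingDomain i) (repellingDomain j) := by
  have hattr {v : ℚ × ℚ} (hv : v ∈ attractingDomain i) : 0 ≤ v.1 * v.2 := by
    cases i
    exacts [hv.1, (mul_self_nonneg _).trans hv]
  have hrep {v : ℚ × ℚ} (hv : v ∈ repellingDomain j) : v.1 * v.2 < 0 := by
    cases j
    exacts [hv.2, hv.trans_le (neg_nonpos.2 (mul_self_nonneg _))]
  exact Set.disjoint_left.2 fun _ h h' => (hattr h).not_gt (hrep h')

theorem shear_mem_attractingDomain (i : Bool) {v : ℚ × ℚ} (hv : v ≠ 0)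
    (h : v ∉ repellingDomain i) : shear i 1 v ∈ attractingDomain i := by
  obtain ⟨x, y⟩ := v
  have hpos : 0 < x * x + y * y := mul_self_add_mul_self_pos hv
  cases i
  · simp only [repellingDomain, attractingDomain, shear, Set.mem_ofPred_eq, not_and, not_lt,
      Bool.false_eq_true, if_false] at h ⊢
    rcases lt_or_ge (x * y) 0 with hxy | hxy
    · have hlt : x * y < -(y * y) := lt_of_not_ge fun hle => (h hle).not_gt hxy
      constructor <;> nlinarith
    · constructor <;> nlinarith
  · simp only [repellingDomain, attractingDomain, shear, Set.mem_ofPred_eq, not_lt, if_true] at h ⊢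
    linarith

theorem shear_mem_repellingDomain (i : Bool) {v : ℚ × ℚ} (hv : v ≠ 0)
    (h : v ∉ attractingDomain i) : shear i (-1) v ∈ repellingDomain i := by
  obtain ⟨x, y⟩ := v
  have hpos : 0 < x * x + y * y := mul_self_add_mul_self_pos hv
  cases i
  · simp only [repellingDomain, attractingDomain, shear, Set.mem_ofPred_eq, not_and, not_lt,
      Bool.false_eq_true, if_false] at h ⊢
    rcases lt_or_ge (x * y) 0 with hxy | hxy
    · constructor <;> nlinarith
    · have hle := h hxy
      constructor <;> nlinarith
  · simp only [repellingDomain, attractingDomain, shear, Set.mem_ofPred_eq, not_le, if_true] at h ⊢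
    linarith

/-- The first column of a matrix, which is the vector used for ping-pong. -/
def firstColumn (g : GL (Fin 2) ℚ) : ℚ × ℚ := (g.val 0 0, g.val 1 0)

theorem firstColumn_ne_zero (g : GL (Fin 2) ℚ) : firstColumn g ≠ 0 := by
  intro h
  obtain ⟨h0, h1⟩ := Prod.ext_iff.1 h
  simp only [firstColumn, Prod.fst_zero, Prod.snd_zero] at h0 h1
  exact g.det_ne_zero (by rw [Matrix.det_fin_two, h0, h1]; ring)

theorem firstColumn_sanovGen_zpow_mul (i : Bool) (e : ℤ) (g : GL (Fin 2) ℚ) :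
    firstColumn (sanovGen i ^ e * g) = shear i e (firstColumn g) := by
  rw [firstColumn, sanovGen_zpow_mul_val i e g.val.eta_fin_two]
  cases i <;> rfl

open scoped Pointwise in
theorem sanov_injective : Function.Injective sanov := by
  refine FreeGroup.injective_lift_of_ping_pong sanovGen
    (fun i => firstColumn ⁻¹' attractingDomain i) (fun i => firstColumn ⁻¹' repellingDomain i)
    (fun i => ?_) (fun i j hij => Disjoint.preimage _ ?_) (fun i j hij => Disjoint.preimage _ ?_)
    (fun i j => (disjoint_attractingDomain_repellingDomain i j).preimage _) ?_ ?_
  · refine ⟨if i then 1 else sanovGen false ^ (1 : ℤ), ?_⟩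
    cases i
    · rw [Set.mem_preimage, if_neg Bool.false_ne_true,
        ← mul_one (sanovGen false ^ (1 : ℤ)), firstColumn_sanovGen_zpow_mul]
      simp [attractingDomain, firstColumn, shear]
    · simp [attractingDomain, firstColumn]
  · cases i <;> cases j
    exacts [absurd rfl hij, disjoint_attractingDomain.symm, disjoint_attractingDomain,
      absurd rfl hij]
  · cases i <;> cases j
    exacts [absurd rfl hij, disjoint_repellingDomain.symm, disjoint_repellingDomain,
      absurd rfl hij]
  · rintro i _ ⟨g, hg, rfl⟩
    have h := firstColumn_sanovGen_zpow_mul i 1 g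
    rw [zpow_one, Int.cast_one] at h
    exact Set.mem_preimage.2 (h ▸ shear_mem_attractingDomain i (firstColumn_ne_zero g) hg)
  · rintro i _ ⟨g, hg, rfl⟩
    have h := firstColumn_sanovGen_zpow_mul i (-1) g
    rw [zpow_neg_one, Int.cast_neg, Int.cast_one] at h
    exact Set.mem_preimage.2 (h ▸ shear_mem_repellingDomain i (firstColumn_ne_zero g) hg)

theorem sanovGen_zpow_mem_range (i : Bool) (e : ℤ) : sanovGen i ^ e ∈ sanov.range :=
  ⟨FreeGroup.of i ^ e, by rw [map_zpow, sanov, FreeGroup.lift_apply_of]⟩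

theorem sanovGen_true_zpow_mul_val {g : GL (Fin 2) ℚ} {a b c d : ℤ} (e : ℤ)
    (hg : g.val = !![1 + 4 * (a : ℚ), 2 * b; 2 * c, 1 + 4 * d]) : (sanovGen true ^ e * g).val =
      !![1 + 4 * ((a + e * c : ℤ) : ℚ), 2 * ((b + e * (1 + 4 * d) : ℤ) : ℚ);
        2 * (c : ℚ), 1 + 4 * (d : ℚ)] := by
  rw [sanovGen_zpow_mul_val true e hg]
  ext i j
  fin_cases i <;> fin_cases j <;> simp <;> ring

theorem sanovGen_false_zpow_mul_val {g : GL (Fin 2) ℚ} {a b c d : ℤ} (e : ℤ)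
    (hg : g.val = !![1 + 4 * (a : ℚ), 2 * b; 2 * c, 1 + 4 * d]) : (sanovGen false ^ e * g).val =
      !![1 + 4 * (a : ℚ), 2 * (b : ℚ);
        2 * ((c + e * (1 + 4 * a) : ℤ) : ℚ), 1 + 4 * ((d + e * b : ℤ) : ℚ)] := by
  rw [sanovGen_zpow_mul_val false e hg]
  ext i j
  fin_cases i <;> fin_cases j <;> simp <;> ring

theorem IsSanov.zpow_mul {g : GL (Fin 2) ℚ} (hg : IsSanov g) (i : Bool) (e : ℤ) :
    IsSanov (sanovGen i ^ e * g) := by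
  obtain ⟨hdet, a, b, c, d, hval⟩ := hg
  refine ⟨?_, ?_⟩
  · rw [Units.val_mul, Matrix.det_mul, hdet, sanovGen_zpow_val]
    cases i <;> simp
  · cases i
    exacts [⟨_, _, _, _, sanovGen_false_zpow_mul_val e hval⟩,
      ⟨_, _, _, _, sanovGen_true_zpow_mul_val e hval⟩]

theorem isSanov_of_mem_range {g : GL (Fin 2) ℚ} (hg : g ∈ sanov.range) : IsSanov g := by
  rw [sanov, FreeGroup.range_lift_eq_closure] at hg
  induction hg using Subgroup.closure_induction_left with
  | one => exact ⟨by simp, 0, 0, 0, 0, by simp [Matrix.one_fin_two]⟩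
  | mul_left x hx y _ ih =>
    obtain ⟨i, rfl⟩ := hx
    exact zpow_one (sanovGen i) ▸ ih.zpow_mul i 1
  | inv_mul_cancel x hx y _ ih =>
    obtain ⟨i, rfl⟩ := hx
    exact zpow_neg_one (sanovGen i) ▸ ih.zpow_mul i (-1)

theorem exists_natAbs_lt_of_ne_zero (a : ℤ) {c : ℤ} (hc : c ≠ 0) :
    ∃ e : ℤ, (1 + 4 * (a + e * c)).natAbs < (1 + 4 * a).natAbs ∨
      (2 * (c + e * (1 + 4 * a))).natAbs < (2 * c).natAbs := by
  by_cases hsign : 0 < c ↔ 0 < 1 + 4 * a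
  · exact ⟨-1, by omega⟩
  · exact ⟨1, by omega⟩

theorem eq_sanovGen_zpow {g : GL (Fin 2) ℚ} {a b d : ℤ} (hdet : g.val.det = 1)
    (hg : g.val = !![1 + 4 * (a : ℚ), 2 * b; 0, 1 + 4 * d]) : g = sanovGen true ^ b := by
  rw [hg, Matrix.det_fin_two_of, mul_zero, sub_zero] at hdet
  have hunit : (1 + 4 * a) * (1 + 4 * d) = 1 := by exact_mod_cast hdet
  obtain rfl : a = 0 := by
    have := Int.isUnit_iff.1 (IsUnit.of_mul_eq_one _ hunit)
    omega
  obtain rfl : d = 0 := by omega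
  refine Units.ext ?_
  rw [hg, sanovGen_zpow_val]
  simp

/-- Euclid's algorithm on the first column. -/
theorem IsSanov.mem_range {g : GL (Fin 2) ℚ} (hg : IsSanov g) : g ∈ sanov.range := by
  obtain ⟨hdet, a, b, c, d, hval⟩ := id hg
  induction hn : (1 + 4 * a).natAbs + (2 * c).natAbs using Nat.strong_induction_on
    generalizing g a b c d with
  | _ n ih =>
    subst hn
    have shear_step (i : Bool) (e : ℤ) (hmem : sanovGen i ^ e * g ∈ sanov.range) :
        g ∈ sanov.range :=
      (Subgroup.mul_mem_cancel_left _ (sanovGen_zpow_mem_range i e)).1 hmem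
    rcases eq_or_ne c 0 with rfl | hc
    · rw [eq_sanovGen_zpow hdet (by simpa using hval)]
      exact sanovGen_zpow_mem_range true b
    · obtain ⟨e, hlt | hlt⟩ := exists_natAbs_lt_of_ne_zero a hc
      · exact shear_step true e (ih _ (Nat.add_lt_add_right hlt _) (hg.zpow_mul true e)
          (hg.zpow_mul true e).1 _ _ _ _ (sanovGen_true_zpow_mul_val e hval) rfl)
      · exact shear_step false e (ih _ (Nat.add_lt_add_left hlt _) (hg.zpow_mul false e)
          (hg.zpow_mul false e).1 _ _ _ _ (sanovGen_false_zpow_mul_val e hval) rfl)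

theorem mem_range_sanov_iff (g : GL (Fin 2) ℚ) : g ∈ sanov.range ↔ IsSanov g :=
  ⟨isSanov_of_mem_range, IsSanov.mem_range⟩

end Sanov

section Cosets

open scoped Pointwise

variable {G : Type*} [Group G] {H : Subgroup G} {X Y : Set G}

/-- The set `X` is covered by finitely many right cosets of the subgroup `H`. -/
def IsCosetFinite (H : Subgroup G) (X : Set G) : Prop :=
  ∃ T : Set G, T.Finite ∧ X ⊆ (H : Set G) * T

theorem IsCosetFinite.mono (hY : IsCosetFinite H Y) (h : X ⊆ Y) : IsCosetFinite H X :=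
  hY.imp fun _ hT => ⟨hT.1, h.trans hT.2⟩

theorem isCosetFinite_of_finite (hX : X.Finite) : IsCosetFinite H X :=
  ⟨X, hX, Set.subset_mul_right X H.one_mem⟩

theorem IsCosetFinite.union (hX : IsCosetFinite H X) (hY : IsCosetFinite H Y) :
    IsCosetFinite H (X ∪ Y) := by
  obtain ⟨T, hT, hXT⟩ := hX
  obtain ⟨U, hU, hYU⟩ := hY
  refine ⟨T ∪ U, hT.union hU, ?_⟩
  rw [Set.mul_union]
  exact Set.union_subset_union hXT hYU

theorem isCosetFinite_biUnion {ι : Type*} {s : Set ι} {X : ι → Set G} (hs : s.Finite)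
    (hX : ∀ i ∈ s, IsCosetFinite H (X i)) : IsCosetFinite H (⋃ i ∈ s, X i) := by
  induction s, hs using Set.Finite.induction_on with
  | empty => simpa using isCosetFinite_of_finite Set.finite_empty
  | insert _ _ ih =>
    rw [Set.biUnion_insert]
    exact (hX _ (Set.mem_insert _ _)).union (ih fun i hi => hX i (Set.mem_insert_of_mem _ hi))

theorem IsCosetFinite.mul (hX : IsCosetFinite H X)
    (hY : ∀ g, IsCosetFinite H ({g} * Y)) : IsCosetFinite H (X * Y) := by
  obtain ⟨T, hT, hXT⟩ := hX
  obtain ⟨U, hU, hTU⟩ := isCosetFinite_biUnion hT fun t _ => hY t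
  refine ⟨U, hU, ?_⟩
  rw [← Set.iUnion₂_mul, Set.biUnion_of_singleton] at hTU
  calc X * Y ⊆ (H : Set G) * (T * Y) := mul_assoc (H : Set G) T Y ▸ Set.mul_subset_mul_right hXT
    _ ⊆ (H : Set G) * (H * U) := Set.mul_subset_mul_left hTU
    _ = H * U := by rw [← mul_assoc, coe_mul_coe]

theorem isCosetFinite_range {α β : Type*} [Finite β] {x : α → G} (residue : α → β)
    (h : ∀ a b, residue a = residue b → x a * (x b)⁻¹ ∈ H) :
    IsCosetFinite H (Set.range x) := by
  refine ⟨Set.range fun b : Set.range residue => x b.2.choose, Set.finite_range _, ?_⟩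
  rintro _ ⟨a, rfl⟩
  refine ⟨_, h a (Set.mem_range_self a : residue a ∈ Set.range residue).choose ?_, _,
    ⟨⟨residue a, a, rfl⟩, rfl⟩, inv_mul_cancel_right _ _⟩
  exact (Exists.choose_spec (Set.mem_range_self a : residue a ∈ Set.range residue)).symm

theorem not_isCosetFinite_univ (hH : H.index = 0) : ¬ IsCosetFinite H Set.univ := by
  rintro ⟨T, hT, huniv⟩
  refine Subgroup.index_eq_zero_iff_infinite.1 hH |>.not_finite ?_
  refine Set.finite_univ_iff.1
    ((hT.image fun t => (QuotientGroup.mk t⁻¹ : G ⧸ H)).subset fun c _ => ?_)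
  obtain ⟨x, rfl⟩ := QuotientGroup.mk_surjective c
  obtain ⟨h, hh, t, ht, hx⟩ := huniv (Set.mem_univ x⁻¹)
  refine ⟨t, ht, QuotientGroup.eq.2 ?_⟩
  rw [inv_inv, ← inv_inv x, ← show h * t = x⁻¹ from hx, mul_inv_rev, mul_inv_cancel_left]
  exact H.inv_mem hh

end Cosets

section SanovCosets

open scoped Pointwise

/-- Extension of scalars from integral to rational invertible matrices. -/
noncomputable abbrev ofGLInt : GL (Fin 2) ℤ →* GL (Fin 2) ℚ :=
  Matrix.GeneralLinearGroup.map (Int.castRingHom ℚ)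

theorem isSanov_of_val_eq_one_add {x : GL (Fin 2) ℚ} {u : ℤˣ} {F : Matrix (Fin 2) (Fin 2) ℤ}
    (hdet : x.val.det = ((u : ℤ) : ℚ))
    (hx : x.val = (Int.castRingHom ℚ).mapMatrix (1 + (4 : ℤ) • F)) : IsSanov x := by
  refine ⟨?_, F 0 0, 2 * F 0 1, 2 * F 1 0, F 1 1, ?_⟩
  · have hu : (1 + (4 : ℤ) • F).det = (u : ℤ) := by
      rw [hx, ← RingHom.map_det] at hdet
      exact Int.cast_injective hdet
    have hmod : (1 + (4 : ℤ) • F).det =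
        1 + 4 * (F 0 0 + F 1 1 + 4 * (F 0 0 * F 1 1) - 4 * (F 0 1 * F 1 0)) := by
      simp only [Matrix.det_fin_two, Matrix.add_apply, Matrix.smul_apply, Matrix.one_fin_two,
        Matrix.of_apply, Matrix.cons_val, smul_eq_mul]
      ring
    rcases Int.units_eq_one_or u with rfl | rfl
    · simpa using hdet
    · rw [hu, Units.val_neg, Units.val_one] at hmod
      omega
  · rw [hx]
    ext i j
    fin_cases i <;> fin_cases j <;> simp [-zsmul_eq_mul] <;> ring

theorem isSanov_conj {g : GL (Fin 2) ℚ} {h : GL (Fin 2) ℤ} {E : Matrix (Fin 2) (Fin 2) ℤ}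
    (hE : h.val = 1 + ((4 * (g⁻¹.val.den * g.val.den) : ℕ) : ℤ) • E) :
    IsSanov (g * ofGLInt h * g⁻¹) := by
  set ι := (Int.castRingHom ℚ).mapMatrix (m := Fin 2)
  have hcast : (ofGLInt h).val = ι h.val := rfl
  refine isSanov_of_val_eq_one_add (u := Matrix.GeneralLinearGroup.det h)
    (F := g.val.num * E * g⁻¹.val.num) ?_ ?_
  · rw [Units.val_mul, Units.val_mul, Matrix.det_mul_right_comm, ← Units.val_mul,
      mul_inv_cancel, Units.val_one, one_mul, hcast, ← RingHom.map_det]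
    rfl
  · have hnum (A : Matrix (Fin 2) (Fin 2) ℚ) : ι A.num = (A.den : ℚ) • A := by
      nth_rw 3 [← Matrix.inv_denom_smul_num A]
      rw [smul_inv_smul₀ (Nat.cast_ne_zero.2 A.den_ne_zero)]
      rfl
    have hone : g.val * g⁻¹.val = 1 := by rw [← Units.val_mul, mul_inv_cancel, Units.val_one]
    change _ = ι _
    rw [Units.val_mul, Units.val_mul, hcast, hE]
    simp only [map_add, map_one, map_zsmul, map_mul, hnum, mul_add, add_mul, mul_one, hone,
      ← Int.cast_smul_eq_zsmul ℚ, mul_smul_comm, smul_mul_assoc, smul_smul, Int.cast_ofNat]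
    push_cast
    rfl

theorem isCosetFinite_singleton_mul_GL2Z (g : GL (Fin 2) ℚ) :
    IsCosetFinite sanov.range ({g} * (GL2Z : Set (GL (Fin 2) ℚ))) := by
  set n := 4 * (g⁻¹.val.den * g.val.den) with hn
  have : NeZero n := ⟨by simp [hn, Matrix.den_ne_zero]⟩
  have hrange := isCosetFinite_range (H := sanov.range) (x := fun h => g * ofGLInt h)
    (fun h : GL (Fin 2) ℤ => h.val.map (Int.cast : ℤ → ZMod n)) fun h k hhk => ?_
  · refine hrange.mono ?_
    rintro _ ⟨_, rfl, _, ⟨h, rfl⟩, rfl⟩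
    exact ⟨h, rfl⟩
  have hdvd (i j) : (n : ℤ) ∣ h.val i j - k.val i j := by
    rw [← ZMod.intCast_eq_intCast_iff_dvd_sub]
    exact (congrFun₂ hhk i j).symm
  choose E hE using hdvd
  have hval : h.val = k.val + (n : ℤ) • Matrix.of E := by
    ext i j
    simp [-zsmul_eq_mul, ← hE]
  rw [mul_inv_rev, ← mul_assoc, mul_assoc g, ← map_inv, ← map_mul]
  refine (isSanov_conj (E := Matrix.of E * k⁻¹.val) ?_).mem_range
  rw [Units.val_mul, hval, add_mul, ← Units.val_mul, mul_inv_cancel, Units.val_one,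
    smul_mul_assoc]

theorem index_range_sanov : sanov.range.index = 0 := by
  have hle : sanov.range ≤ Matrix.GeneralLinearGroup.det.ker := fun x hx =>
    Units.ext (isSanov_of_mem_range hx).1
  have : Infinite ℚˣ := Infinite.of_injective
    (fun n : ℕ => Units.mk0 ((n : ℚ) + 1) n.cast_add_one_ne_zero) fun m n h => by
      simpa using congrArg Units.val h
  have hdvd := Subgroup.index_dvd_of_le hle
  rw [Subgroup.index_ker, MonoidHom.range_eq_top_of_surjective _
    Matrix.GeneralLinearGroup.det_surjective, Subgroup.card_top,
    Nat.card_eq_zero_of_infinite] at hdvd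
  exact Nat.eq_zero_of_zero_dvd hdvd

end SanovCosets

section Rounds

variable {α : Type*} {step : List α → List α} {k l : ℕ} {L : List α} {s : α}

/-- The elements obtained from those of `L` in `k` rounds, each of which adds the elements that
`step` derives from the present ones. -/
def rounds (step : List α → List α) (k : ℕ) (L : List α) : List α :=
  (fun K => K ++ step K)^[k] L

theorem mem_rounds_succ :
    s ∈ rounds step (k + 1) L ↔ s ∈ rounds step k L ∨ s ∈ step (rounds step k L) := by
  rw [rounds, Function.iterate_succ_apply', List.mem_append, rounds]

theorem rounds_mono (h : k ≤ l) : rounds step k L ⊆ rounds step l L := by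
  induction h with
  | refl => exact List.Subset.refl _
  | step _ ih => exact fun s hs => mem_rounds_succ.2 (Or.inl (ih hs))

theorem subset_rounds : L ⊆ rounds step k L :=
  rounds_mono k.zero_le

theorem exists_forall_mem_rounds {Q : Set α} (hQ : Q.Finite)
    (h : ∀ s ∈ Q, ∃ k, s ∈ rounds step k L) : ∃ k, ∀ s ∈ Q, s ∈ rounds step k L := by
  choose! k hk using h
  obtain ⟨m, hm⟩ := (hQ.image k).bddAbove
  exact ⟨m, fun s hs => rounds_mono (hm ⟨s, hs, rfl⟩) (hk s hs)⟩

theorem exists_step_subset_rounds (h : {s | ∃ k, s ∈ rounds step k L}.Finite) :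
    ∃ k, step (rounds step k L) ⊆ rounds step k L := by
  obtain ⟨k, hk⟩ := exists_forall_mem_rounds h fun _ hs => hs
  exact ⟨k, fun s hs => hk s ⟨k + 1, mem_rounds_succ.2 (Or.inr hs)⟩⟩

end Rounds

/-- Finite automata over `M`, given by their edges: `(p, g, q)` leads from the state `p` to the
state `q` and reads `g`. -/
abbrev Automaton (M : Type*) := List (ℕ × M × ℕ)

section Paths

variable {M : Type*} [Monoid M] {E E' : Automaton M} {p q r : ℕ} {g h : M}

/-- `Path E p g q`: some path of the automaton `E` from `p` to `q` reads `g`. -/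
inductive Path (E : Automaton M) : ℕ → M → ℕ → Prop
  | nil (p : ℕ) : Path E p 1 p
  | cons {p q r : ℕ} {g h : M} : (p, g, q) ∈ E → Path E q h r → Path E p (g * h) r

namespace Path

theorem single (he : (p, g, q) ∈ E) : Path E p g q := by
  simpa using Path.cons he (Path.nil q)

theorem trans (h₁ : Path E p g q) (h₂ : Path E q h r) : Path E p (g * h) r := by
  induction h₁ with
  | nil p => rwa [one_mul]
  | cons he _ ih => rw [mul_assoc]; exact Path.cons he (ih h₂)

theorem mem_of_invariant (hp : Path E p g q) {Y : ℕ → Set M}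
    (hY : ∀ p g q, (p, g, q) ∈ E → ∀ x ∈ Y p, x * g ∈ Y q) {x : M} (hx : x ∈ Y p) :
    x * g ∈ Y q := by
  induction hp generalizing x with
  | nil p => rwa [mul_one]
  | cons he _ ih => rw [← mul_assoc]; exact ih (hY _ _ _ he _ hx)

theorem apply_eq (hp : Path E p g q) {β : Type*} {c : ℕ → β}
    (hc : ∀ p g q, (p, g, q) ∈ E → c p = c q) : c p = c q := by
  induction hp with
  | nil p => rfl
  | cons he _ ih => rw [hc _ _ _ he, ih]

theorem map (hp : Path E p g q) (i : ℕ → ℕ)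
    (hi : ∀ p g q, (p, g, q) ∈ E → (i p, g, i q) ∈ E') : Path E' (i p) g (i q) := by
  induction hp with
  | nil p => exact Path.nil _
  | cons he _ ih => exact Path.cons (hi _ _ _ he) ih

theorem eq_or_exists_edge (hp : Path E p g q) : q = p ∨ ∃ e ∈ E, e.2.2 = q := by
  induction hp with
  | nil p => exact Or.inl rfl
  | cons he _ ih =>
    rcases ih with rfl | ih
    · exact Or.inr ⟨_, he, rfl⟩
    · exact Or.inr ih

end Path

/-- All compositions of two of the given transitions. -/
def composites (S : List (ℕ × M × ℕ)) : List (ℕ × M × ℕ) :=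
  S.flatMap fun x => (S.filter fun y => y.1 = x.2.2).map fun y => (x.1, x.2.1 * y.2.1, y.2.2)

theorem mem_composites {S : List (ℕ × M × ℕ)} {s : ℕ × M × ℕ} : s ∈ composites S ↔
    ∃ p g q h r, (p, g, q) ∈ S ∧ (q, h, r) ∈ S ∧ s = (p, g * h, r) := by
  simp only [composites, List.mem_flatMap, List.mem_map, List.mem_filter, decide_eq_true_eq]
  constructor
  · rintro ⟨⟨p, g, q⟩, hx, ⟨_, h, r⟩, ⟨hy, rfl⟩, rfl⟩
    exact ⟨p, g, _, h, r, hx, hy, rfl⟩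
  · rintro ⟨p, g, q, h, r, hx, hy, rfl⟩
    exact ⟨_, hx, _, ⟨hy, rfl⟩, rfl⟩

/-- The transitions derived in `k` rounds of composition from the edges of `E` and the trivial
loops at the states that occur in `B`. -/
def facts (E : Automaton M) (B : List (ℕ × M)) (k : ℕ) : List (ℕ × M × ℕ) :=
  rounds composites k (E ++ B.map fun b => (b.1, 1, b.1))

variable {B : List (ℕ × M)} {k : ℕ}

theorem edge_mem_facts {e : ℕ × M × ℕ} (he : e ∈ E) : e ∈ facts E B k :=
  subset_rounds (List.mem_append_left _ he)

theorem loop_mem_facts (hp : (p, g) ∈ B) : (p, 1, p) ∈ facts E B k :=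
  subset_rounds (List.mem_append_right _ (List.mem_map_of_mem hp))

theorem path_of_mem_facts (h : (p, g, q) ∈ facts E B k) : Path E p g q := by
  induction k generalizing p g q with
  | zero =>
    rcases List.mem_append.1 h with h | h
    · exact Path.single h
    · obtain ⟨b, -, hb⟩ := List.mem_map.1 h
      cases hb
      exact Path.nil _
  | succ k ih =>
    rcases mem_rounds_succ.1 h with h | h
    · exact ih h
    · obtain ⟨p, g, q, h, r, hx, hy, hs⟩ := mem_composites.1 h
      cases hs
      exact (ih hx).trans (ih hy)

theorem exists_mem_facts (hp : Path E p g q) (hq : ∃ y, (q, y) ∈ B) :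
    ∃ k, (p, g, q) ∈ facts E B k := by
  induction hp with
  | nil p => exact ⟨0, loop_mem_facts hq.choose_spec⟩
  | cons he _ ih =>
    obtain ⟨k, hk⟩ := ih hq
    exact ⟨k + 1, mem_rounds_succ.2
      (Or.inr (mem_composites.2 ⟨_, _, _, _, _, edge_mem_facts he, hk, rfl⟩))⟩

end Paths

section Saturation

variable {G : Type*} [Group G] {ι : Type*}

/-- The element of `G` that a letter of the free group stands for. -/
def letter (φ : FreeGroup ι →* G) (x : ι × Bool) : G :=
  φ (FreeGroup.mk [x])

/-- Some transition of `S` leads from the vertex `u` to the vertex `v` and produces `o`, that is,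
it reads the element `g` with `u.2 * g = o * v.2`. -/
def Rel (S : List (ℕ × G × ℕ)) (u : ℕ × G) (o : G) (v : ℕ × G) : Prop :=
  (u.1, u.2⁻¹ * o * v.2, v.1) ∈ S

/-- A run through the vertices `V` that produces the letters of the given word one by one. -/
def RelWord (φ : FreeGroup ι →* G) (V : List (ℕ × G)) (S : List (ℕ × G × ℕ)) :
    ℕ × G → List (ι × Bool) → ℕ × G → Prop
  | u, [], v => Rel S u 1 v
  | u, x :: l, v => ∃ m ∈ V, Rel S u (letter φ x) m ∧ RelWord φ V S m l v

open scoped Classical in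
/-- The vertices of `V` that are reached from those of `D` while `o` is produced. -/
noncomputable def reach (V : List (ℕ × G)) (S : List (ℕ × G × ℕ)) (D : List (ℕ × G)) (o : G) :
    List (ℕ × G) :=
  V.filter fun v => ∃ u ∈ D, Rel S u o v

/-- The vertices of `V` that are reached from the starting vertices while nothing is produced. -/
noncomputable def startSet (A : List ℕ) (V : List (ℕ × G)) (S : List (ℕ × G × ℕ)) :
    List (ℕ × G) :=
  reach V S (A.map fun a => (Nat.pair a 0, 1)) 1

/-- The vertices of `V` that are reached from the starting vertices while the word `l` is
produced. -/
noncomputable def wordSet (φ : FreeGroup ι →* G) (A : List ℕ) (V : List (ℕ × G))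
    (S : List (ℕ × G × ℕ)) (l : List (ι × Bool)) : List (ℕ × G) :=
  l.foldl (fun D x => reach V S D (letter φ x)) (startSet A V S)

variable {φ : FreeGroup ι →* G} {E : Automaton G} {A : List ℕ} {B V : List (ℕ × G)}
  {S : List (ℕ × G × ℕ)} {n k : ℕ} {p q : ℕ} {g : G} {u v : ℕ × G} {f : FreeGroup ι}
  {l : List (ι × Bool)}

theorem map_mk_cons (x : ι × Bool) (l : List (ι × Bool)) :
    φ (FreeGroup.mk (x :: l)) = letter φ x * φ (FreeGroup.mk l) := by
  rw [letter, ← map_mul, FreeGroup.mul_mk, List.singleton_append]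

theorem letter_mul_letter_not (x : ι × Bool) : letter φ x * letter φ (x.1, !x.2) = 1 := by
  rw [letter, letter, ← map_mul, ← map_one φ, FreeGroup.mul_mk, FreeGroup.one_eq_mk]
  exact congrArg φ (Quot.sound FreeGroup.Red.Step.cons_not)

theorem path_of_rel {o : G} (h : Rel (facts E B k) u o v) :
    Path E u.1 (u.2⁻¹ * o * v.2) v.1 :=
  path_of_mem_facts h

theorem rel_one_of_edge {y : G} (he : (p, g, q) ∈ E) :
    Rel (facts E B k) (p, y) 1 (q, y * g) := by
  simpa [Rel] using edge_mem_facts he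

theorem rel_of_mul_eq {o x y t : G} (hp : (p, t) ∈ B) (hy : y = o * x) :
    Rel (facts E B k) (p, y) o (p, x) := by
  simpa [Rel, hy, mul_assoc] using loop_mem_facts hp

theorem mem_reach {D : List (ℕ × G)} {o : G} :
    v ∈ reach V S D o ↔ v ∈ V ∧ ∃ u ∈ D, Rel S u o v := by
  simp [reach]

theorem mem_startSet :
    v ∈ startSet A V S ↔ v ∈ V ∧ ∃ a ∈ A, Rel S (Nat.pair a 0, 1) 1 v := by
  simp [startSet, mem_reach]

theorem wordSet_concat (x : ι × Bool) :
    wordSet φ A V S (l ++ [x]) = reach V S (wordSet φ A V S l) (letter φ x) := by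
  simp [wordSet]

theorem wordSet_sublist : (wordSet φ A V S l).Sublist V := by
  induction l using List.reverseRecOn with
  | nil => exact List.filter_sublist
  | append_singleton l x _ => rw [wordSet_concat]; exact List.filter_sublist

theorem path_of_mem_wordSet (hv : v ∈ wordSet φ A V (facts E B k) l) :
    ∃ a ∈ A, Path E (Nat.pair a 0) (φ (FreeGroup.mk l) * v.2) v.1 := by
  induction l using List.reverseRecOn generalizing v with
  | nil =>
    obtain ⟨-, a, ha, h⟩ := mem_startSet.1 hv
    exact ⟨a, ha, by simpa [← FreeGroup.one_eq_mk] using path_of_rel h⟩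
  | append_singleton l x ih =>
    rw [wordSet_concat, mem_reach] at hv
    obtain ⟨-, u, hu, h⟩ := hv
    obtain ⟨a, ha, hp⟩ := ih hu
    refine ⟨a, ha, ?_⟩
    convert hp.trans (path_of_rel h) using 1
    rw [← FreeGroup.mul_mk, map_mul, letter]
    group

variable [Fintype ι]

/-- The images of the elements of length at most one of the free group. -/
noncomputable def labels (φ : FreeGroup ι →* G) : List G :=
  1 :: (Finset.univ.toList.map (letter φ))

/-- Multiplies the group elements of the vertices `V` from the left by all letters. -/
noncomputable def letterMultiples (φ : FreeGroup ι →* G) (V : List (ℕ × G)) : List (ℕ × G) :=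
  V.flatMap fun v => Finset.univ.toList.map fun x => (v.1, letter φ x * v.2)

/-- A vertex `(p, y)` stands for the elements of the coset `φ.range * y` that are read on
arrival at the state `p`. The base vertices `B` carry coset representatives; all other vertices
are multiples of them by words of length at most `n`. -/
noncomputable def vertices (φ : FreeGroup ι →* G) (B : List (ℕ × G)) (n : ℕ) : List (ℕ × G) :=
  rounds (letterMultiples φ) n B

/-- Benois' saturation: the vertices `V`, spanned by the base vertices `B`, and the transitions
`S` account for all that the automaton `E` reads from the states `pair a 0` with `a ∈ A`, modulo
cancellation in the free group. -/
structure IsSaturated (φ : FreeGroup ι →* G) (E : Automaton G) (A : List ℕ)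
    (B V : List (ℕ × G)) (S : List (ℕ × G × ℕ)) : Prop where
  comp : ∀ o₁ ∈ labels φ, ∀ o₂ ∈ labels φ, ∀ o₃ ∈ labels φ, o₁ * o₂ = o₃ →
    ∀ u ∈ V, ∀ v ∈ V, ∀ w ∈ V, Rel S u o₁ v → Rel S v o₂ w → Rel S u o₃ w
  closed : ∀ b ∈ B, ∀ e ∈ E, e.1 = b.1 → (e.2.2, b.2 * e.2.1) ∈ V
  start : ∀ a ∈ A, (Nat.pair a 0, 1) ∈ B
  separated : ∀ b ∈ B, ∀ c ∈ B, b.2 = c.2 ∨ b.2 * c.2⁻¹ ∉ φ.range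

theorem one_mem_labels : (1 : G) ∈ labels φ :=
  List.mem_cons_self

theorem letter_mem_labels (x : ι × Bool) : letter φ x ∈ labels φ :=
  List.mem_cons_of_mem _ (List.mem_map_of_mem (Finset.mem_toList.2 (Finset.mem_univ x)))

theorem mem_letterMultiples {V : List (ℕ × G)} :
    v ∈ letterMultiples φ V ↔ ∃ x y, (v.1, y) ∈ V ∧ v.2 = letter φ x * y := by
  simp only [letterMultiples, List.mem_flatMap, List.mem_map, Finset.mem_toList, Finset.mem_univ,
    true_and]
  constructor
  · rintro ⟨⟨p, y⟩, hv, x, rfl⟩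
    exact ⟨x, y, hv, rfl⟩
  · rintro ⟨x, y, hv, hy⟩
    exact ⟨_, hv, x, Prod.ext rfl hy.symm⟩

theorem mem_vertices_of_mem (hb : (p, g) ∈ B) {w : List (ι × Bool)} (hw : w.length ≤ n) :
    (p, φ (FreeGroup.mk w) * g) ∈ vertices φ B n := by
  induction w generalizing n with
  | nil => simpa [← FreeGroup.one_eq_mk, vertices] using subset_rounds hb
  | cons x w ih =>
    obtain ⟨n, rfl⟩ := Nat.exists_eq_add_of_lt (Nat.lt_of_lt_of_le w.length.zero_lt_succ hw)
    refine mem_rounds_succ.2 (Or.inr (mem_letterMultiples.2 ⟨x, _, ih ?_, ?_⟩))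
    · simpa using hw
    · rw [map_mk_cons, mul_assoc]

namespace IsSaturated

theorem relWord_of_rel_one (hs : IsSaturated φ E A B V S) {m : ℕ × G} (hu : u ∈ V)
    (hm : m ∈ V) (hv : v ∈ V) (h : Rel S u 1 m)
    (hl : RelWord φ V S m l v) : RelWord φ V S u l v := by
  cases l with
  | nil =>
    exact hs.comp 1 one_mem_labels 1 one_mem_labels 1 one_mem_labels (mul_one 1)
      u hu m hm v hv h hl
  | cons x l =>
    obtain ⟨m', hm', h₁, h₂⟩ := hl
    exact ⟨m', hm', hs.comp 1 one_mem_labels _ (letter_mem_labels x) _ (letter_mem_labels x)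
      (one_mul _) u hu m hm m' hm' h h₁, h₂⟩

theorem relWord_of_rel_letter [DecidableEq ι] (hs : IsSaturated φ E A B V S) {m : ℕ × G}
    (hu : u ∈ V) (hm : m ∈ V) (hv : v ∈ V) {x : ι × Bool} (h : Rel S u (letter φ x) m)
    (hl : RelWord φ V S m f.toWord v) :
    RelWord φ V S u (FreeGroup.mk [x] * f).toWord v := by
  have hw : (FreeGroup.mk [x] * f).toWord = FreeGroup.reduce (x :: f.toWord) := by
    conv_lhs => rw [← FreeGroup.mk_toWord (x := f), FreeGroup.mul_mk, FreeGroup.toWord_mk,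
      List.singleton_append]
  rw [hw, FreeGroup.reduce.cons, FreeGroup.reduce_toWord]
  cases hf : f.toWord with
  | nil => exact ⟨m, hm, h, hf ▸ hl⟩
  | cons y l =>
    rw [hf] at hl
    dsimp only
    split_ifs with hxy
    · obtain ⟨m', hm', h₁, h₂⟩ := hl
      obtain rfl : y = (x.1, !x.2) := Prod.ext hxy.1.symm (by simp [hxy.2])
      refine hs.relWord_of_rel_one hu hm' hv ?_ h₂
      exact hs.comp _ (letter_mem_labels x) _ (letter_mem_labels _) 1 one_mem_labels
        (letter_mul_letter_not x) u hu m hm m' hm' h h₁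
    · exact ⟨m, hm, h, hl⟩

theorem exists_base [DecidableEq ι]
    (hs : IsSaturated φ E A B (vertices φ B n) (facts E B k)) {m : ℕ} (hm : m ≤ n)
    (hv : v ∈ vertices φ B m) : ∃ f t, (v.1, t) ∈ B ∧ v.2 = φ f * t ∧
      ∀ w ∈ vertices φ B n, ∀ f' : FreeGroup ι,
        RelWord φ (vertices φ B n) (facts E B k) (v.1, t) f'.toWord w →
          RelWord φ (vertices φ B n) (facts E B k) v (f * f').toWord w := by
  induction m generalizing v with
  | zero => exact ⟨1, v.2, hv, by simp, fun w _ f' h => by rwa [one_mul]⟩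
  | succ m ih =>
    rcases mem_rounds_succ.1 hv with hv' | hv'
    · exact ih (Nat.le_of_succ_le hm) hv'
    obtain ⟨x, y, hy, hxy⟩ := mem_letterMultiples.1 hv'
    obtain ⟨f, t, ht, rfl, hf⟩ := ih (Nat.le_of_succ_le hm) hy
    refine ⟨FreeGroup.mk [x] * f, t, ht, ?_, fun w hw f' h => ?_⟩
    · rw [hxy, map_mul, mul_assoc, letter]
    · rw [mul_assoc]
      exact hs.relWord_of_rel_letter (rounds_mono hm hv)
        (rounds_mono (Nat.le_of_succ_le hm) hy) hw (rel_of_mul_eq ht hxy) (hf w hw f' h)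

theorem exists_relWord [DecidableEq ι]
    (hs : IsSaturated φ E A B (vertices φ B n) (facts E B k)) (hp : Path E p g q) {t : G}
    (ht : (p, t) ∈ B) : ∃ f : FreeGroup ι, ∃ t', (q, t') ∈ B ∧ t * g = φ f * t' ∧
      RelWord φ (vertices φ B n) (facts E B k) (p, t) f.toWord (q, t') := by
  induction hp generalizing t with
  | nil p =>
    refine ⟨1, t, ht, by simp, ?_⟩
    rw [FreeGroup.toWord_one]
    exact rel_of_mul_eq ht (one_mul t).symm
  | cons he _ ih =>
    have hv := hs.closed _ ht _ he rfl
    obtain ⟨f, t', ht', hy, hf⟩ := hs.exists_base le_rfl hv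
    obtain ⟨f', t'', ht'', hy', hr⟩ := ih ht'
    refine ⟨f * f', t'', ht'', ?_, ?_⟩
    · rw [← mul_assoc, show t * _ = _ from hy, mul_assoc, hy', map_mul, mul_assoc]
    · exact hs.relWord_of_rel_one (subset_rounds ht) hv (subset_rounds ht'')
        (rel_one_of_edge he) (hf _ (subset_rounds ht'') f' hr)

theorem mem_foldl_reach (hs : IsSaturated φ E A B V S) (hv : v ∈ V) {D : List (ℕ × G)}
    {m : ℕ × G} (hD : ∀ u ∈ D, u ∈ V ∧ ∀ w ∈ V, Rel S u 1 w → w ∈ D) (hm : m ∈ D)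
    (hl : RelWord φ V S m l v) : v ∈ l.foldl (fun D x => reach V S D (letter φ x)) D := by
  induction l generalizing D m with
  | nil => exact (hD m hm).2 v hv hl
  | cons x l ih =>
    obtain ⟨m', hm', h₁, h₂⟩ := hl
    refine ih (fun u hu => ?_) (mem_reach.2 ⟨hm', m, hm, h₁⟩) h₂
    obtain ⟨huV, z, hz, hzu⟩ := mem_reach.1 hu
    refine ⟨huV, fun w hw huw => mem_reach.2 ⟨hw, z, hz, ?_⟩⟩
    exact hs.comp _ (letter_mem_labels x) 1 one_mem_labels _ (letter_mem_labels x) (mul_one _)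
      z (hD z hz).1 u huV w hw hzu huw

theorem mem_wordSet_of_path [DecidableEq ι]
    (hs : IsSaturated φ E A B (vertices φ B n) (facts E B k)) {a : ℕ} (ha : a ∈ A)
    (hp : Path E (Nat.pair a 0) g q) : ∃ f t, (q, t) ∈ B ∧ g = φ f * t ∧
      (q, t) ∈ wordSet φ A (vertices φ B n) (facts E B k) f.toWord := by
  have hstart : ∀ b ∈ A, (Nat.pair b 0, 1) ∈ vertices φ B n :=
    fun b hb => subset_rounds (hs.start b hb)
  obtain ⟨f, t, ht, hx, hr⟩ := hs.exists_relWord hp (hs.start a ha)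
  rw [one_mul] at hx
  refine ⟨f, t, ht, hx, hs.mem_foldl_reach (subset_rounds ht) (fun u hu => ?_) ?_ hr⟩
  · obtain ⟨huV, b, hb, hbu⟩ := mem_startSet.1 hu
    refine ⟨huV, fun w hw huw => mem_startSet.2 ⟨hw, b, hb, ?_⟩⟩
    exact hs.comp 1 one_mem_labels 1 one_mem_labels 1 one_mem_labels (mul_one 1)
      _ (hstart b hb) u huV w hw hbu huw
  · exact mem_startSet.2 ⟨hstart a ha, a, ha, rel_of_mul_eq (hs.start a ha) (one_mul 1).symm⟩

theorem path_iff [DecidableEq ι]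
    (hs : IsSaturated φ E A B (vertices φ B n) (facts E B k)) (hφ : Function.Injective φ)
    (hE : ∀ p g q, (p, g, q) ∈ E → p.unpair.1 = q.unpair.1) {a : ℕ} (ha : a ∈ A) {t : G}
    (ht : (q, t) ∈ B) :
    Path E (Nat.pair a 0) (φ f * t) (Nat.pair a 1) ↔
      (Nat.pair a 1, t) ∈ wordSet φ A (vertices φ B n) (facts E B k) f.toWord := by
  constructor
  · intro hp
    obtain ⟨f', t', ht', hx, hmem⟩ := hs.mem_wordSet_of_path ha hp
    have hrange : t * t'⁻¹ ∈ φ.range := by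
      refine ⟨f⁻¹ * f', ?_⟩
      rw [map_mul, map_inv, inv_mul_eq_iff_eq_mul, ← mul_assoc, hx, mul_inv_cancel_right]
    obtain rfl : t = t' := (hs.separated _ ht _ ht').resolve_right (not_not_intro hrange)
    rwa [hφ (mul_right_cancel hx)]
  · intro h
    obtain ⟨b, -, hp⟩ := path_of_mem_wordSet h
    rw [FreeGroup.mk_toWord] at hp
    obtain rfl : b = a := by simpa using hp.apply_eq hE
    exact hp

end IsSaturated

end Saturation

section Exploration

open scoped Pointwise

variable {G : Type*} [Group G] {ι : Type*} [Fintype ι] [DecidableEq ι]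

/-- A pair `(x, D)` stands for the reduced words with last letter `x` that lead to the set `D` of
vertices; the pairs of all words that are one letter longer. -/
noncomputable def successors (φ : FreeGroup ι →* G) (V : List (ℕ × G)) (S : List (ℕ × G × ℕ))
    (K : List (Option (ι × Bool) × List (ℕ × G))) : List (Option (ι × Bool) × List (ℕ × G)) :=
  K.flatMap fun s => (Finset.univ.toList.filter fun x : ι × Bool => s.1 ≠ some (x.1, !x.2)).map
    fun x => (some x, reach V S s.2 (letter φ x))

/-- The pairs of a last letter and a set of vertices that belong to the reduced words of length
at most `j`. -/
noncomputable def explored (φ : FreeGroup ι →* G) (A : List ℕ) (V : List (ℕ × G))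
    (S : List (ℕ × G × ℕ)) (j : ℕ) : List (Option (ι × Bool) × List (ℕ × G)) :=
  rounds (successors φ V S) j [(none, startSet A V S)]

variable {φ : FreeGroup ι →* G} {E : Automaton G} {A : List ℕ} {B V : List (ℕ × G)}
  {S : List (ℕ × G × ℕ)} {n k j : ℕ}

theorem mem_successors {K : List (Option (ι × Bool) × List (ℕ × G))}
    {s : Option (ι × Bool) × List (ℕ × G)} : s ∈ successors φ V S K ↔
      ∃ t ∈ K, ∃ x : ι × Bool, t.1 ≠ some (x.1, !x.2) ∧
        (some x, reach V S t.2 (letter φ x)) = s := by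
  simp [successors]

omit [Fintype ι] [DecidableEq ι] in
theorem isReduced_concat {l : List (ι × Bool)} {x : ι × Bool} :
    FreeGroup.IsReduced (l ++ [x]) ↔
      FreeGroup.IsReduced l ∧ l.getLast? ≠ some (x.1, !x.2) := by
  rw [FreeGroup.IsReduced, List.isChain_append]
  simp only [List.IsChain.singleton, true_and, List.head?_cons, Option.mem_def,
    Option.some.injEq, forall_eq']
  refine and_congr_right fun _ => ⟨fun h hx => ?_, fun h y hy hyx => ?_⟩
  · simpa using h _ hx rfl
  · by_contra hne
    exact h (hy.trans (congrArg some (Prod.ext hyx (Bool.eq_not.2 hne))))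

theorem exists_word_of_mem_explored {s : Option (ι × Bool) × List (ℕ × G)}
    (hs : s ∈ explored φ A V S j) :
    ∃ l, FreeGroup.IsReduced l ∧ s = (l.getLast?, wordSet φ A V S l) := by
  induction j generalizing s with
  | zero => exact ⟨[], by simp [FreeGroup.IsReduced], List.mem_singleton.1 hs⟩
  | succ j ih =>
    rcases mem_rounds_succ.1 hs with hs | hs
    · exact ih hs
    · obtain ⟨t, ht, x, hx, rfl⟩ := mem_successors.1 hs
      obtain ⟨l, hl, rfl⟩ := ih ht
      exact ⟨l ++ [x], isReduced_concat.2 ⟨hl, hx⟩, by simp [wordSet_concat]⟩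

theorem mem_explored_of_closed
    (hj : successors φ V S (explored φ A V S j) ⊆ explored φ A V S j)
    {l : List (ι × Bool)} (hl : FreeGroup.IsReduced l) :
    (l.getLast?, wordSet φ A V S l) ∈ explored φ A V S j := by
  induction l using List.reverseRecOn with
  | nil => exact subset_rounds (List.mem_singleton_self _)
  | append_singleton l x ih =>
    obtain ⟨hl, hx⟩ := isReduced_concat.1 hl
    refine hj (mem_successors.2 ⟨_, ih hl, x, hx, ?_⟩)
    simp [wordSet_concat]

open scoped Classical in
/-- Elements outside the cosets of the base vertices are accepted by no component, and such
elements exist; this is the alternative `P []`. -/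
theorem IsSaturated.exists_iff (hs : IsSaturated φ E A B (vertices φ B n) (facts E B k))
    (hφ : Function.Injective φ) (hG : ¬ IsCosetFinite φ.range Set.univ)
    (hE : ∀ p g q, (p, g, q) ∈ E → p.unpair.1 = q.unpair.1)
    (hj : successors φ (vertices φ B n) (facts E B k)
      (explored φ A (vertices φ B n) (facts E B k) j) ⊆
        explored φ A (vertices φ B n) (facts E B k) j) (P : List ℕ → Prop) :
    (∃ x : G, P (A.filter fun a => Path E (Nat.pair a 0) x (Nat.pair a 1))) ↔
      P [] ∨ ∃ s ∈ explored φ A (vertices φ B n) (facts E B k) j, ∃ b ∈ B,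
        P (A.filter fun a => (Nat.pair a 1, b.2) ∈ s.2) := by
  have hin {b} (hb : b ∈ B) (f : FreeGroup ι) :
      (A.filter fun a => Path E (Nat.pair a 0) (φ f * b.2) (Nat.pair a 1)) =
        A.filter fun a => (Nat.pair a 1, b.2) ∈
          wordSet φ A (vertices φ B n) (facts E B k) f.toWord :=
    List.filter_congr fun a ha => by simp only [hs.path_iff hφ hE ha hb]
  have hout {x} (hx : ∀ b ∈ B, ∀ f, φ f * b.2 ≠ x) :
      (A.filter fun a => Path E (Nat.pair a 0) x (Nat.pair a 1)) = [] := by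
    refine List.filter_eq_nil_iff.2 fun a ha hp => ?_
    obtain ⟨f, t, ht, hxt, -⟩ := hs.mem_wordSet_of_path ha (of_decide_eq_true hp)
    exact hx _ ht f hxt.symm
  constructor
  · rintro ⟨x, hx⟩
    by_cases h : ∃ b ∈ B, ∃ f, φ f * b.2 = x
    · obtain ⟨b, hb, f, rfl⟩ := h
      rw [hin hb f] at hx
      exact Or.inr ⟨_, mem_explored_of_closed hj FreeGroup.isReduced_toWord, b, hb, hx⟩
    · rw [hout fun b hb f hf => h ⟨b, hb, f, hf⟩] at hx
      exact Or.inl hx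
  · rintro (h | ⟨s, hsj, b, hb, h⟩)
    · obtain ⟨x, hx⟩ : ∃ x, ∀ b ∈ B, ∀ f, φ f * b.2 ≠ x := by
        by_contra! hall
        refine hG ⟨{t | ∃ p, (p, t) ∈ B}, ?_, fun x _ => ?_⟩
        · exact (B.finite_toSet.image Prod.snd).subset fun t ⟨p, hp⟩ => ⟨_, hp, rfl⟩
        · obtain ⟨b, hb, f, hf⟩ := hall x
          exact ⟨_, ⟨f, rfl⟩, b.2, ⟨b.1, hb⟩, hf⟩
      exact ⟨x, by rwa [hout hx]⟩
    · obtain ⟨l, hl, rfl⟩ := exists_word_of_mem_explored hsj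
      refine ⟨φ (FreeGroup.mk l) * b.2, ?_⟩
      rwa [hin hb, FreeGroup.toWord_mk, hl.reduce_eq]

end Exploration

section Existence

open scoped Pointwise

variable {G : Type*} [Group G] {ι : Type*} [Fintype ι] {φ : FreeGroup ι →* G}
  {E : Automaton G} {A : List ℕ} {B : List (ℕ × G)}

theorem exists_facts_complete (E : Automaton G) {V : List (ℕ × G)} (O : List G)
    (hV : ∀ v ∈ V, ∃ y, (v.1, y) ∈ B) : ∃ k, ∀ u ∈ V, ∀ o ∈ O, ∀ v ∈ V,
      Path E u.1 (u.2⁻¹ * o * v.2) v.1 → Rel (facts E B k) u o v := by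
  let transition : (ℕ × G) × G × (ℕ × G) → ℕ × G × ℕ := fun z =>
    (z.1.1, z.1.2⁻¹ * z.2.1 * z.2.2.2, z.2.2.1)
  have hQ : (transition '' ({u | u ∈ V} ×ˢ {o | o ∈ O} ×ˢ {v | v ∈ V}) ∩
      {s | Path E s.1 s.2.1 s.2.2}).Finite :=
    ((V.finite_toSet.prod (O.finite_toSet.prod V.finite_toSet)).image _).inter_of_left _
  have hfacts : ∀ s ∈ transition '' ({u | u ∈ V} ×ˢ {o | o ∈ O} ×ˢ {v | v ∈ V}) ∩
      {s | Path E s.1 s.2.1 s.2.2}, ∃ k, s ∈ facts E B k := by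
    rintro _ ⟨⟨⟨u, o, v⟩, ⟨-, -, hv⟩, rfl⟩, hp⟩
    exact exists_mem_facts hp (hV v hv)
  obtain ⟨k, hk⟩ := exists_forall_mem_rounds hQ hfacts
  exact ⟨k, fun u hu o ho v hv hp => hk _ ⟨⟨(u, o, v), ⟨hu, ho, hv⟩, rfl⟩, hp⟩⟩

theorem exists_explored_closed [DecidableEq ι] (φ : FreeGroup ι →* G) (A : List ℕ)
    (V : List (ℕ × G)) (S : List (ℕ × G × ℕ)) :
    ∃ j, successors φ V S (explored φ A V S j) ⊆ explored φ A V S j := by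
  refine exists_step_subset_rounds (Set.Finite.subset
    (Set.finite_univ.prod V.sublists.finite_toSet) ?_)
  rintro s ⟨j, hs⟩
  obtain ⟨l, -, rfl⟩ := exists_word_of_mem_explored hs
  exact ⟨Set.mem_univ _, List.mem_sublists.2 wordSet_sublist⟩

theorem exists_representatives {H : Subgroup G} {X : Set G} (hX : IsCosetFinite H X) :
    ∃ T : Set G, T.Finite ∧ 1 ∈ T ∧ X ⊆ (H : Set G) * T ∧
      ∀ t ∈ T, ∀ u ∈ T, t = u ∨ t * u⁻¹ ∉ H := by
  classical
  obtain ⟨T, hT, hXT⟩ := hX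
  let coset : G → Quotient (QuotientGroup.rightRel H) := Quotient.mk _
  let rep : Quotient (QuotientGroup.rightRel H) → G := fun c => if c = coset 1 then 1 else c.out
  have coset_rep (c) : coset (rep c) = c := by
    by_cases hc : c = coset 1
    · simp [rep, hc]
    · simp [rep, hc, coset]
  have coset_eq {x y : G} : coset x = coset y ↔ y * x⁻¹ ∈ H :=
    Quotient.eq.trans QuotientGroup.rightRel_apply
  refine ⟨(rep ∘ coset) '' insert 1 T, (hT.insert 1).image _, ⟨1, by simp [rep]⟩, ?_, ?_⟩
  · intro x hx
    obtain ⟨h, hh, t, ht, rfl⟩ := hXT hx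
    refine ⟨h * t * (rep (coset t))⁻¹, ?_, _, ⟨t, Set.mem_insert_of_mem _ ht, rfl⟩, by simp⟩
    refine coset_eq.1 ((coset_rep _).trans (coset_eq.2 ?_))
    simpa using hh
  · rintro _ ⟨t, -, rfl⟩ _ ⟨u, -, rfl⟩
    refine or_iff_not_imp_right.2 fun h => ?_
    have hut := coset_eq.2 (not_not.1 h)
    simp only [Function.comp_apply, coset_rep] at hut ⊢
    rw [hut]

theorem finite_endpoints (E : Automaton G) (A : List ℕ) :
    {q | ∃ a ∈ A, ∃ x, Path E (Nat.pair a 0) x q}.Finite := by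
  refine (A.map (Nat.pair · 0) ++ E.map fun e => e.2.2).finite_toSet.subset ?_
  rintro q ⟨a, ha, x, hp⟩
  rcases hp.eq_or_exists_edge with h | ⟨e, he, h⟩
  · exact List.mem_append_left _ (List.mem_map.2 ⟨a, ha, h.symm⟩)
  · exact List.mem_append_right _ (List.mem_map.2 ⟨e, he, h⟩)

theorem exists_base_vertices
    (hcover : IsCosetFinite φ.range {x | ∃ a ∈ A, ∃ q, Path E (Nat.pair a 0) x q}) :
    ∃ B n, (∀ a ∈ A, (Nat.pair a 0, 1) ∈ B) ∧
      (∀ b ∈ B, ∀ e ∈ E, e.1 = b.1 → (e.2.2, b.2 * e.2.1) ∈ vertices φ B n) ∧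
      ∀ b ∈ B, ∀ c ∈ B, b.2 = c.2 ∨ b.2 * c.2⁻¹ ∉ φ.range := by
  classical
  obtain ⟨T, hT, hone, hXT, hsep⟩ := exists_representatives hcover
  let R : Set (ℕ × G) :=
    {s | s.2 ∈ T ∧ ∃ a ∈ A, ∃ f, Path E (Nat.pair a 0) (φ f * s.2) s.1}
  have hR : R.Finite := ((finite_endpoints E A).prod hT).subset
    fun s ⟨hs, a, ha, f, hp⟩ => ⟨⟨a, ha, _, hp⟩, hs⟩
  have hstep : ∀ s ∈ R, ∀ e ∈ E, e.1 = s.1 → ∃ (w : List (ι × Bool)) (t : G),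
      (e.2.2, t) ∈ R ∧ s.2 * e.2.1 = φ (FreeGroup.mk w) * t := by
    rintro ⟨p, t⟩ ⟨ht, a, ha, f, hp⟩ ⟨_, g, q⟩ he rfl
    have hp' := hp.trans (Path.single he)
    obtain ⟨_, ⟨f', rfl⟩, t', ht', hx : φ f' * t' = _⟩ := hXT ⟨a, ha, q, hp'⟩
    refine ⟨(f⁻¹ * f').toWord, t', ⟨ht', a, ha, f', hx ▸ hp'⟩, ?_⟩
    rw [FreeGroup.mk_toWord, map_mul, map_inv, mul_assoc, hx]
    group
  choose! w t hwt using hstep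
  obtain ⟨n, hn⟩ := ((hR.prod E.finite_toSet).image fun z => (w z.1 z.2).length).bddAbove
  refine ⟨hR.toFinset.toList, n, ?_, ?_, ?_⟩ <;>
    simp only [Finset.mem_toList, Set.Finite.mem_toFinset]
  · exact fun a ha => ⟨hone, a, ha, 1, by simpa using Path.nil _⟩
  · intro b hb e he heb
    obtain ⟨ht, hbe⟩ := hwt b hb e he heb
    rw [hbe]
    exact mem_vertices_of_mem (by simpa using ht) (hn ⟨(b, e), ⟨hb, he⟩, rfl⟩)
  · exact fun b hb c hc => hsep _ hb.1 _ hc.1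

theorem exists_mem_base {n : ℕ} {v : ℕ × G} (hv : v ∈ vertices φ B n) :
    ∃ y, (v.1, y) ∈ B := by
  induction n generalizing v with
  | zero => exact ⟨v.2, hv⟩
  | succ n ih =>
    rcases mem_rounds_succ.1 hv with hv | hv
    · exact ih hv
    · obtain ⟨x, y, hy, -⟩ := mem_letterMultiples.1 hv
      exact ih (v := (v.1, y)) hy

theorem exists_isSaturated
    (hcover : IsCosetFinite φ.range {x | ∃ a ∈ A, ∃ q, Path E (Nat.pair a 0) x q}) :
    ∃ B n k, IsSaturated φ E A B (vertices φ B n) (facts E B k) := by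
  obtain ⟨B, n, hstart, hclosed, hsep⟩ := exists_base_vertices hcover
  obtain ⟨k, hk⟩ := exists_facts_complete E (labels φ) fun v =>
    exists_mem_base (φ := φ) (B := B) (n := n)
  refine ⟨B, n, k, ?_, hclosed, hstart, hsep⟩
  intro o₁ _ o₂ _ o₃ ho₃ ho u hu v _ w hw huv hvw
  refine hk u hu o₃ ho₃ w hw ?_
  convert (path_of_rel huv).trans (path_of_rel hvw) using 1
  rw [← ho]
  group

end Existence

section Checking

variable {α β : Type*} [Primcodable α] [Primcodable β]

theorem primrec_rounds {step : α → List β → List β} (hstep : Primrec₂ step) {k : α → ℕ}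
    {L : α → List β} (hk : Primrec k) (hL : Primrec L) :
    Primrec fun a => rounds (step a) (k a) (L a) :=
  Primrec.nat_iterate hk hL (Primrec.list_append.comp Primrec.snd hstep)

variable {G : Type*} [Group G] [Primcodable G]

theorem primrec_composites (hmul : Primrec₂ fun g h : G => g * h) :
    Primrec (composites : List (ℕ × G × ℕ) → List (ℕ × G × ℕ)) := by
  refine Primrec.list_flatMap Primrec.id ?_
  refine Primrec.list_map (f := fun z : List (ℕ × G × ℕ) × (ℕ × G × ℕ) =>
    z.1.filter fun y => y.1 = z.2.2.2) (g := fun z y => (z.2.1, z.2.2.1 * y.2.1, y.2.2)) ?_ ?_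
  · refine primrec_filter Primrec.fst (Primrec.eq.comp (Primrec.fst.comp Primrec.snd) ?_)
    exact Primrec.snd.comp (Primrec.snd.comp (Primrec.snd.comp Primrec.fst))
  · have source : Primrec fun z : (List (ℕ × G × ℕ) × ℕ × G × ℕ) × ℕ × G × ℕ => z.1.2.1 :=
      Primrec.fst.comp (Primrec.snd.comp Primrec.fst)
    have first : Primrec fun z : (List (ℕ × G × ℕ) × ℕ × G × ℕ) × ℕ × G × ℕ => z.1.2.2.1 :=
      Primrec.fst.comp (Primrec.snd.comp (Primrec.snd.comp Primrec.fst))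
    have second : Primrec fun z : (List (ℕ × G × ℕ) × ℕ × G × ℕ) × ℕ × G × ℕ => z.2.2.1 :=
      Primrec.fst.comp (Primrec.snd.comp Primrec.snd)
    exact source.pair ((hmul.comp first second).pair
      (Primrec.snd.comp (Primrec.snd.comp Primrec.snd)))

theorem primrec_facts (hmul : Primrec₂ fun g h : G => g * h) {E : α → Automaton G}
    {B : α → List (ℕ × G)} {k : α → ℕ} (hE : Primrec E) (hB : Primrec B) (hk : Primrec k) :
    Primrec fun a => facts (E a) (B a) (k a) := by
  refine primrec_rounds (step := fun _ => composites)
    ((primrec_composites hmul).comp Primrec.snd) hk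
    (Primrec.list_append.comp hE (Primrec.list_map hB ?_))
  have state : Primrec fun z : α × ℕ × G => z.2.1 := Primrec.fst.comp Primrec.snd
  exact state.pair ((Primrec.const 1).pair state)

theorem primrecPred_rel (hmul : Primrec₂ fun g h : G => g * h)
    (hinv : Primrec fun g : G => g⁻¹) {S : α → List (ℕ × G × ℕ)}
    {u v : α → ℕ × G} {o : α → G} (hS : Primrec S) (hu : Primrec u) (ho : Primrec o)
    (hv : Primrec v) : PrimrecPred fun a => Rel (S a) (u a) (o a) (v a) :=
  primrecPred_mem hS ((Primrec.fst.comp hu).pair ((hmul.comp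
    (hmul.comp (hinv.comp (Primrec.snd.comp hu)) ho) (Primrec.snd.comp hv)).pair
      (Primrec.fst.comp hv)))

theorem primrec_reach (hmul : Primrec₂ fun g h : G => g * h)
    (hinv : Primrec fun g : G => g⁻¹) {V D : α → List (ℕ × G)} {S : α → List (ℕ × G × ℕ)}
    {o : α → G} (hV : Primrec V) (hS : Primrec S) (hD : Primrec D) (ho : Primrec o) :
    Primrec fun a => reach (V a) (S a) (D a) (o a) := by
  classical
  refine primrec_filter hV (primrecPred_exists_mem (α := α × ℕ × G) (hD.comp Primrec.fst) ?_)
  exact primrecPred_rel hmul hinv (hS.comp (Primrec.fst.comp Primrec.fst)) Primrec.snd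
    (ho.comp (Primrec.fst.comp Primrec.fst)) (Primrec.snd.comp Primrec.fst)

theorem primrec_startSet (hmul : Primrec₂ fun g h : G => g * h)
    (hinv : Primrec fun g : G => g⁻¹) {A : α → List ℕ} {V : α → List (ℕ × G)}
    {S : α → List (ℕ × G × ℕ)} (hA : Primrec A) (hV : Primrec V) (hS : Primrec S) :
    Primrec fun a => startSet (A a) (V a) (S a) :=
  primrec_reach hmul hinv hV hS (Primrec.list_map hA
    ((Primrec₂.natPair.comp Primrec.snd (Primrec.const 0)).pair (Primrec.const 1)))
    (Primrec.const 1)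

variable {ι : Type*} [Fintype ι] {φ : FreeGroup ι →* G}

theorem primrecPred_comp (hmul : Primrec₂ fun g h : G => g * h)
    (hinv : Primrec fun g : G => g⁻¹) {V : α → List (ℕ × G)} {S : α → List (ℕ × G × ℕ)}
    (hV : Primrec V) (hS : Primrec S) :
    PrimrecPred fun a => ∀ o₁ ∈ labels φ, ∀ o₂ ∈ labels φ, ∀ o₃ ∈ labels φ, o₁ * o₂ = o₃ →
      ∀ u ∈ V a, ∀ v ∈ V a, ∀ w ∈ V a,
        Rel (S a) u o₁ v → Rel (S a) v o₂ w → Rel (S a) u o₃ w := by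
  refine primrecPred_forall_mem (Primrec.const _) ?_
  refine primrecPred_forall_mem (α := α × G) (Primrec.const _) ?_
  refine primrecPred_forall_mem (α := (α × G) × G) (Primrec.const _) ?_
  refine primrecPred_imp (α := ((α × G) × G) × G) (Primrec.eq.comp (hmul.comp
    (Primrec.snd.comp (Primrec.fst.comp Primrec.fst)) (Primrec.snd.comp Primrec.fst))
    Primrec.snd) ?_
  have input : Primrec fun z : ((α × G) × G) × G => z.1.1.1 :=
    Primrec.fst.comp (Primrec.fst.comp Primrec.fst)
  refine primrecPred_forall_mem (hV.comp input) ?_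
  refine primrecPred_forall_mem (α := (((α × G) × G) × G) × ℕ × G)
    (hV.comp (input.comp Primrec.fst)) ?_
  refine primrecPred_forall_mem (α := ((((α × G) × G) × G) × ℕ × G) × ℕ × G)
    (hV.comp (input.comp (Primrec.fst.comp Primrec.fst))) ?_
  let X := (((((α × G) × G) × G) × ℕ × G) × ℕ × G) × ℕ × G
  have outer : Primrec fun z : X => z.1.1.1 := Primrec.fst.comp (Primrec.fst.comp Primrec.fst)
  have hS' : Primrec fun z : X => S z.1.1.1.1.1.1 := hS.comp (input.comp outer)
  have hu : Primrec fun z : X => z.1.1.2 := Primrec.snd.comp (Primrec.fst.comp Primrec.fst)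
  have hv : Primrec fun z : X => z.1.2 := Primrec.snd.comp Primrec.fst
  have hw : Primrec fun z : X => z.2 := Primrec.snd
  have ho₁ : Primrec fun z : X => z.1.1.1.1.1.2 :=
    Primrec.snd.comp (Primrec.fst.comp (Primrec.fst.comp outer))
  have ho₂ : Primrec fun z : X => z.1.1.1.1.2 := Primrec.snd.comp (Primrec.fst.comp outer)
  have ho₃ : Primrec fun z : X => z.1.1.1.2 := Primrec.snd.comp outer
  exact primrecPred_imp (primrecPred_rel hmul hinv hS' hu ho₁ hv)
    (primrecPred_imp (primrecPred_rel hmul hinv hS' hv ho₂ hw)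
      (primrecPred_rel hmul hinv hS' hu ho₃ hw))

theorem primrecPred_closed (hmul : Primrec₂ fun g h : G => g * h) {E : α → Automaton G}
    {B V : α → List (ℕ × G)} (hE : Primrec E) (hB : Primrec B) (hV : Primrec V) :
    PrimrecPred fun a => ∀ b ∈ B a, ∀ e ∈ E a, e.1 = b.1 → (e.2.2, b.2 * e.2.1) ∈ V a := by
  refine primrecPred_forall_mem hB ?_
  refine primrecPred_forall_mem (α := α × ℕ × G) (hE.comp Primrec.fst) ?_
  let X := (α × ℕ × G) × ℕ × G × ℕ
  have base : Primrec fun z : X => z.1.2 := Primrec.snd.comp Primrec.fst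
  have edge : Primrec fun z : X => z.2 := Primrec.snd
  refine primrecPred_imp (Primrec.eq.comp (Primrec.fst.comp edge) (Primrec.fst.comp base))
    (primrecPred_mem (hV.comp (Primrec.fst.comp Primrec.fst)) ?_)
  exact (Primrec.snd.comp (Primrec.snd.comp edge)).pair
    (hmul.comp (Primrec.snd.comp base) (Primrec.fst.comp (Primrec.snd.comp edge)))

theorem primrecPred_separated (hmul : Primrec₂ fun g h : G => g * h)
    (hinv : Primrec fun g : G => g⁻¹) {H : Subgroup G} (hH : PrimrecPred (· ∈ H))
    {B : α → List (ℕ × G)} (hB : Primrec B) :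
    PrimrecPred fun a => ∀ b ∈ B a, ∀ c ∈ B a, b.2 = c.2 ∨ b.2 * c.2⁻¹ ∉ H := by
  refine primrecPred_forall_mem hB ?_
  refine primrecPred_forall_mem (α := α × ℕ × G) (hB.comp Primrec.fst) ?_
  have first : Primrec fun z : (α × ℕ × G) × ℕ × G => z.1.2.2 :=
    Primrec.snd.comp (Primrec.snd.comp Primrec.fst)
  have second : Primrec fun z : (α × ℕ × G) × ℕ × G => z.2.2 := Primrec.snd.comp Primrec.snd
  exact (Primrec.eq.comp first second).or (hH.comp (hmul.comp first (hinv.comp second))).not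

theorem primrecPred_isSaturated (hmul : Primrec₂ fun g h : G => g * h)
    (hinv : Primrec fun g : G => g⁻¹) (hH : PrimrecPred (· ∈ φ.range)) {E : α → Automaton G}
    {A : α → List ℕ} {B V : α → List (ℕ × G)} {S : α → List (ℕ × G × ℕ)} (hE : Primrec E)
    (hA : Primrec A) (hB : Primrec B) (hV : Primrec V) (hS : Primrec S) :
    PrimrecPred fun a => IsSaturated φ (E a) (A a) (B a) (V a) (S a) := by
  have hstart : PrimrecPred fun a => ∀ b ∈ A a, (Nat.pair b 0, 1) ∈ B a :=
    primrecPred_forall_mem hA (primrecPred_mem (hB.comp Primrec.fst)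
      ((Primrec₂.natPair.comp Primrec.snd (Primrec.const 0)).pair (Primrec.const 1)))
  refine ((primrecPred_comp (φ := φ) hmul hinv hV hS).and ((primrecPred_closed hmul hE hB hV).and
    (hstart.and (primrecPred_separated hmul hinv hH hB)))).of_eq fun a => ?_
  exact ⟨fun ⟨h₁, h₂, h₃, h₄⟩ => ⟨h₁, h₂, h₃, h₄⟩, fun ⟨h₁, h₂, h₃, h₄⟩ => ⟨h₁, h₂, h₃, h₄⟩⟩

variable [Primcodable ι]

theorem primrec_vertices (hmul : Primrec₂ fun g h : G => g * h) {B : α → List (ℕ × G)}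
    {n : α → ℕ} (hB : Primrec B) (hn : Primrec n) :
    Primrec fun a => vertices φ (B a) (n a) := by
  refine primrec_rounds (step := fun _ => letterMultiples φ)
    (Primrec.list_flatMap Primrec.snd ?_) hn hB
  have vertex : Primrec fun z : ((α × List (ℕ × G)) × ℕ × G) × ι × Bool => z.1.2 :=
    Primrec.snd.comp Primrec.fst
  exact Primrec.list_map (Primrec.const _) ((Primrec.fst.comp vertex).pair
    (hmul.comp ((Primrec.dom_finite (letter φ)).comp Primrec.snd) (Primrec.snd.comp vertex)))

variable [DecidableEq ι]

theorem primrec_successors (hmul : Primrec₂ fun g h : G => g * h)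
    (hinv : Primrec fun g : G => g⁻¹) {V : α → List (ℕ × G)} {S : α → List (ℕ × G × ℕ)}
    {K : α → List (Option (ι × Bool) × List (ℕ × G))} (hV : Primrec V) (hS : Primrec S)
    (hK : Primrec K) : Primrec fun a => successors φ (V a) (S a) (K a) := by
  refine Primrec.list_flatMap hK (Primrec.list_map (primrec_filter (Primrec.const _) ?_) ?_)
  · exact (Primrec.eq.comp (Primrec.fst.comp (Primrec.snd.comp Primrec.fst))
      ((Primrec.dom_finite fun x : ι × Bool => some (x.1, !x.2)).comp Primrec.snd)).not
  · exact (Primrec.option_some.comp Primrec.snd).pair (primrec_reach hmul hinv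
      (hV.comp (Primrec.fst.comp Primrec.fst)) (hS.comp (Primrec.fst.comp Primrec.fst))
      (Primrec.snd.comp (Primrec.snd.comp Primrec.fst))
      ((Primrec.dom_finite (letter φ)).comp Primrec.snd))

theorem primrec_explored (hmul : Primrec₂ fun g h : G => g * h)
    (hinv : Primrec fun g : G => g⁻¹) {A : α → List ℕ} {V : α → List (ℕ × G)}
    {S : α → List (ℕ × G × ℕ)} {j : α → ℕ} (hA : Primrec A) (hV : Primrec V) (hS : Primrec S)
    (hj : Primrec j) : Primrec fun a => explored φ (A a) (V a) (S a) (j a) :=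
  primrec_rounds (step := fun a => successors φ (V a) (S a)) (primrec_successors hmul hinv
    (hV.comp Primrec.fst) (hS.comp Primrec.fst) Primrec.snd) hj (Primrec.list_cons.comp
      ((Primrec.const none).pair (primrec_startSet hmul hinv hA hV hS)) (Primrec.const []))

end Checking

section Search

theorem exists_computable_of_certificate {Cert : Type*} [Primcodable Cert]
    {Valid Answer : ℕ → Cert → Prop} {Q : ℕ → Prop} (hValid : PrimrecRel Valid)
    (hAnswer : PrimrecRel Answer) (hex : ∀ n, ∃ c, Valid n c)
    (hcorrect : ∀ n c, Valid n c → (Answer n c ↔ Q n)) :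
    ∃ f : ℕ → Bool, Computable f ∧ ∀ n, f n = true ↔ Q n := by
  classical
  let verdict : ℕ → ℕ → Option Bool := fun n m => (Encodable.decode (α := Cert) m).bind fun c =>
    if Valid n c then some (decide (Answer n c)) else none
  have hverdict : Primrec₂ verdict := by
    have input : Primrec fun z : (ℕ × ℕ) × Cert => z.1.1 := Primrec.fst.comp Primrec.fst
    exact Primrec.option_bind (Primrec.decode.comp Primrec.snd)
      (Primrec.ite (hValid.comp input Primrec.snd) (Primrec.option_some.comp
        (hAnswer.decide.comp input Primrec.snd)) (Primrec.const none))
  have verdict_correct {n m : ℕ} {b : Bool} (h : b ∈ verdict n m) : b = true ↔ Q n := by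
    obtain ⟨c, -, hc⟩ := Option.bind_eq_some_iff.1 h
    split_ifs at hc with hv
    rw [← hcorrect n c hv, ← Option.some.inj hc, decide_eq_true_iff]
  have hdom (n : ℕ) : (Nat.rfindOpt (verdict n)).Dom := by
    obtain ⟨c, hc⟩ := hex n
    exact Nat.rfindOpt_dom.2 ⟨Encodable.encode c, decide (Answer n c), by simp [verdict, hc]⟩
  refine ⟨fun n => (Nat.rfindOpt (verdict n)).get (hdom n), ?_, fun n => ?_⟩
  · exact (Partrec.rfindOpt hverdict.to_comp).of_eq fun n => (Part.some_get (hdom n)).symm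
  · obtain ⟨m, hm⟩ := Nat.rfindOpt_spec (Part.get_mem (hdom n))
    exact verdict_correct hm

open scoped Classical in
theorem primrecPred_exists_accepted {α β G : Type*} [Primcodable α] [Primcodable β]
    [Primcodable G] {A : α → List ℕ} {B : α → List (ℕ × G)} {K : α → List (β × List (ℕ × G))}
    {P : α → List ℕ → Prop} (hA : Primrec A) (hB : Primrec B) (hK : Primrec K)
    (hP : PrimrecRel P) : PrimrecPred fun a => ∃ s ∈ K a, ∃ b ∈ B a,
      P a ((A a).filter fun c => (Nat.pair c 1, b.2) ∈ s.2) := by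
  refine primrecPred_exists_mem hK ?_
  refine primrecPred_exists_mem (α := α × β × List (ℕ × G)) (hB.comp Primrec.fst) ?_
  let X := (α × β × List (ℕ × G)) × ℕ × G
  have input : Primrec fun z : X => z.1.1 := Primrec.fst.comp Primrec.fst
  have reached : Primrec fun z : X => z.1.2.2 :=
    Primrec.snd.comp (Primrec.snd.comp Primrec.fst)
  have target : Primrec₂ fun (z : X) c => (Nat.pair c 1, z.2.2) :=
    (Primrec₂.natPair.comp Primrec.snd (Primrec.const 1)).pair
      (Primrec.snd.comp (Primrec.snd.comp Primrec.fst))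
  exact hP.comp input (primrec_filter (hA.comp input)
    (primrecPred_mem (reached.comp Primrec.fst) target))

variable {G : Type*} [Group G] [Primcodable G] {ι : Type*} [Finite ι] {φ : FreeGroup ι →* G}

open scoped Classical in
theorem exists_computable_satisfiable (hmul : Primrec₂ fun g h : G => g * h)
    (hinv : Primrec fun g : G => g⁻¹) (hφ : Function.Injective φ)
    (hH : PrimrecPred (· ∈ φ.range)) (hG : ¬ IsCosetFinite φ.range Set.univ)
    {E : ℕ → Automaton G} {A : ℕ → List ℕ} {P : ℕ → List ℕ → Prop} (hE : Primrec E)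
    (hA : Primrec A) (hP : PrimrecRel P)
    (hcomp : ∀ n p g q, (p, g, q) ∈ E n → p.unpair.1 = q.unpair.1)
    (hfin : ∀ n, IsCosetFinite φ.range
      {x | ∃ a ∈ A n, ∃ q, Path (E n) (Nat.pair a 0) x q}) :
    ∃ f : ℕ → Bool, Computable f ∧ ∀ n, f n = true ↔
      ∃ x : G, P n ((A n).filter fun a => Path (E n) (Nat.pair a 0) x (Nat.pair a 1)) := by
  let := Fintype.ofFinite ι
  let := Primcodable.ofEquiv _ (Fintype.equivFin ι)
  let Cert := List (ℕ × G) × ℕ × ℕ × ℕ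
  let V (c : Cert) := vertices φ c.1 c.2.1
  let S (n : ℕ) (c : Cert) := facts (E n) c.1 c.2.2.1
  let K (n : ℕ) (c : Cert) := explored φ (A n) (V c) (S n c) c.2.2.2
  have hn : Primrec fun z : ℕ × Cert => z.1 := Primrec.fst
  have hB : Primrec fun z : ℕ × Cert => z.2.1 := Primrec.fst.comp Primrec.snd
  have params : Primrec fun z : ℕ × Cert => z.2.2 := Primrec.snd.comp Primrec.snd
  have hV : Primrec fun z : ℕ × Cert => V z.2 := primrec_vertices hmul hB (Primrec.fst.comp params)
  have hS : Primrec fun z : ℕ × Cert => S z.1 z.2 :=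
    primrec_facts hmul (hE.comp hn) hB (Primrec.fst.comp (Primrec.snd.comp params))
  have hK : Primrec fun z : ℕ × Cert => K z.1 z.2 :=
    primrec_explored hmul hinv (hA.comp hn) hV hS (Primrec.snd.comp (Primrec.snd.comp params))
  have hValid : PrimrecRel fun n c => IsSaturated φ (E n) (A n) c.1 (V c) (S n c) ∧
      ∀ s ∈ successors φ (V c) (S n c) (K n c), s ∈ K n c :=
    (primrecPred_isSaturated hmul hinv hH (hE.comp hn) (hA.comp hn) hB hV hS).and
      (primrecPred_forall_mem (α := ℕ × Cert) (primrec_successors hmul hinv hV hS hK)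
        (primrecPred_mem (hK.comp Primrec.fst) Primrec.snd))
  have hAnswer : PrimrecRel fun n (c : Cert) => P n [] ∨ ∃ s ∈ K n c, ∃ b ∈ c.1,
      P n ((A n).filter fun a => (Nat.pair a 1, b.2) ∈ s.2) :=
    (hP.comp hn (Primrec.const [])).or
      (primrecPred_exists_accepted (hA.comp hn) hB hK (hP.comp (hn.comp Primrec.fst) Primrec.snd))
  refine exists_computable_of_certificate hValid hAnswer (fun n => ?_) (fun n c h => ?_)
  · obtain ⟨B, m, k, hs⟩ := exists_isSaturated (hfin n)
    obtain ⟨j, hj⟩ := exists_explored_closed φ (A n) (vertices φ B m) (facts (E n) B k)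
    exact ⟨(B, m, k, j), hs, hj⟩
  · exact (h.1.exists_iff hφ hG (hcomp n) h.2 (P n)).symm

end Search

section Constructions

open scoped Pointwise

variable {M : Type*}

/-- The automaton `E` with the state `p` renamed to `i p`. -/
def renameStates (i : ℕ → ℕ) (E : Automaton M) : Automaton M :=
  E.map fun e => (i e.1, e.2.1, i e.2.2)

theorem mem_renameStates {i : ℕ → ℕ} {E : Automaton M} {p q : ℕ} {g : M} :
    (p, g, q) ∈ renameStates i E ↔ ∃ p' q', (p', g, q') ∈ E ∧ i p' = p ∧ i q' = q := by
  simp [renameStates]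

/-- The automaton `E` with the label `g` replaced by `f g`. -/
def mapLabels {M' : Type*} (f : M → M') (E : Automaton M) : Automaton M' :=
  E.map fun e => (e.1, f e.2.1, e.2.2)

theorem mem_mapLabels {M' : Type*} {f : M → M'} {E : Automaton M} {p q : ℕ} {h : M'} :
    (p, h, q) ∈ mapLabels f E ↔ ∃ g, (p, g, q) ∈ E ∧ f g = h := by
  simp [mapLabels]

/-- The disjoint union of the automata `E a` for `a` in `l`, in which the state `p` of `E a` is
renamed to `Nat.pair a p`. -/
def disjointUnion (l : List ℕ) (E : ℕ → Automaton M) : Automaton M :=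
  l.flatMap fun a => renameStates (Nat.pair a) (E a)

theorem mem_disjointUnion {l : List ℕ} {E : ℕ → Automaton M} {p q : ℕ} {g : M} :
    (p, g, q) ∈ disjointUnion l E ↔
      ∃ a ∈ l, ∃ p' q', (p', g, q') ∈ E a ∧ Nat.pair a p' = p ∧ Nat.pair a q' = q := by
  simp only [disjointUnion, List.mem_flatMap, mem_renameStates]

theorem unpair_fst_eq_of_mem_disjointUnion {l : List ℕ} {E : ℕ → Automaton M} {p q : ℕ} {g : M}
    (h : (p, g, q) ∈ disjointUnion l E) : p.unpair.1 = q.unpair.1 := by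
  obtain ⟨a, -, p, q, -, rfl, rfl⟩ := mem_disjointUnion.1 h
  simp only [Nat.unpair_pair]

/-- The family of sets attached to the states of an automaton that is glued from two automata, the
state `p` of the first being renamed to `2 * p + 2` and the state `p` of the second to
`2 * p + 3`. -/
def glue (initial final : Set M) (first second : ℕ → Set M) : ℕ → Set M
  | 0 => initial
  | 1 => final
  | q + 2 => if q % 2 = 0 then first (q / 2) else second (q / 2)

variable {initial final : Set M} {first second : ℕ → Set M} {p q : ℕ}

theorem glue_two_mul_add_two : glue initial final first second (2 * p + 2) = first p := by
  simp [glue]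

theorem glue_two_mul_add_three : glue initial final first second (2 * p + 3) = second p := by
  simp [glue, Nat.add_mod, show (2 * p + 1) / 2 = p by lia]

theorem glue_subset {Y : Set M} (hi : initial ⊆ Y) (hf : final ⊆ Y) (h₁ : ∀ p, first p ⊆ Y)
    (h₂ : ∀ p, second p ⊆ Y) : glue initial final first second q ⊆ Y := by
  rcases q with _ | _ | q
  · exact hi
  · exact hf
  · rw [glue]
    split_ifs
    · exact h₁ _
    · exact h₂ _

variable [Monoid M] {E E₁ E₂ : Automaton M} {g x : M}

theorem Path.rename {E' : Automaton M} (h : Path E p g q) {i : ℕ → ℕ}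
    (hi : renameStates i E ⊆ E') : Path E' (i p) g (i q) :=
  h.map i fun p _ q he => hi (mem_renameStates.2 ⟨p, q, he, rfl, rfl⟩)

theorem Path.mapLabels {M' : Type*} [Monoid M'] (f : M →* M') (h : Path E p x q) :
    Path (mapLabels f E) p (f x) q := by
  induction h with
  | nil p => exact (map_one f).symm ▸ Path.nil p
  | cons he _ ih => exact (map_mul f _ _).symm ▸ Path.cons (mem_mapLabels.2 ⟨_, he, rfl⟩) ih

theorem Path.of_silent_edges {p' q' : ℕ} (hp : (p, 1, p') ∈ E) (h : Path E p' x q')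
    (hq : (q', 1, q) ∈ E) : Path E p x q := by
  simpa only [one_mul, mul_one] using ((Path.single hp).trans h).trans (Path.single hq)

/-- The elements that `E` reads on the paths from the state `0` to the state `q`. The automata
below have the initial state `0` and the accepting state `1`. -/
def language (E : Automaton M) (q : ℕ) : Set M := {x | Path E 0 x q}

theorem one_mem_language : 1 ∈ language E 0 := Path.nil 0

theorem mul_mem_language (hx : x ∈ language E p) (he : (p, g, q) ∈ E) : x * g ∈ language E q :=
  Path.trans hx (Path.single he)

theorem language_subset_of_invariant {Y : ℕ → Set M} (h1 : 1 ∈ Y 0)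
    (hY : ∀ p g q, (p, g, q) ∈ E → ∀ x ∈ Y p, x * g ∈ Y q) : language E q ⊆ Y q := fun x hx => by
  simpa only [one_mul] using Path.mem_of_invariant hx hY h1

theorem language_mapLabels {M' : Type*} [Monoid M'] (f : M →* M') :
    language (mapLabels f E) q = f '' language E q := by
  refine Set.Subset.antisymm ?_ ?_
  · refine language_subset_of_invariant (Y := fun q => f '' language E q)
      ⟨1, one_mem_language, map_one f⟩ ?_
    rintro p _ q he _ ⟨x, hx, rfl⟩
    obtain ⟨g, hg, rfl⟩ := mem_mapLabels.1 he
    exact ⟨x * g, mul_mem_language hx hg, map_mul f x g⟩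
  · rintro _ ⟨x, hx, rfl⟩
    exact Path.mapLabels f hx

/-- The automaton for a finite set. -/
def listNfa (l : List M) : Automaton M := l.map fun g => (0, g, 1)

/-- The automaton for a union. -/
def unionNfa (E₁ E₂ : Automaton M) : Automaton M :=
  [(0, 1, 2), (0, 1, 3), (4, 1, 1), (5, 1, 1)] ++
    (renameStates (2 * · + 2) E₁ ++ renameStates (2 * · + 3) E₂)

/-- The automaton for a product of two sets with the element `g` in between. -/
def concatNfa (E₁ : Automaton M) (g : M) (E₂ : Automaton M) : Automaton M :=
  [(0, 1, 2), (4, g, 3), (5, 1, 1)] ++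
    (renameStates (2 * · + 2) E₁ ++ renameStates (2 * · + 3) E₂)

/-- The automaton for a generated submonoid. -/
def starNfa (E : Automaton M) : Automaton M :=
  [(0, 1, 3), (3, 1, 2), (4, 1, 3), (3, 1, 1)] ++ renameStates (2 * · + 2) E

theorem language_listNfa (l : List M) : language (listNfa l) 1 = {x | x ∈ l} := by
  refine Set.Subset.antisymm (language_subset_of_invariant
    (Y := fun q => if q = 0 then {1} else {x | x ∈ l}) rfl ?_)
    fun x hx => Path.single (List.mem_map_of_mem hx)
  rintro p g q he x hx
  obtain ⟨g, hg, he⟩ := List.mem_map.1 he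
  cases he
  obtain rfl : x = 1 := hx
  simpa using hg

theorem language_unionNfa_subset : language (unionNfa E₁ E₂) q ⊆
    glue {1} (language E₁ 1 ∪ language E₂ 1) (language E₁) (language E₂) q := by
  refine language_subset_of_invariant rfl fun p g q he x hx => ?_
  simp only [unionNfa, List.mem_append, List.mem_cons, Prod.mk.injEq, List.not_mem_nil, or_false,
    mem_renameStates] at he
  rcases he with (⟨rfl, rfl, rfl⟩ | ⟨rfl, rfl, rfl⟩ | ⟨rfl, rfl, rfl⟩ | ⟨rfl, rfl, rfl⟩) |
    ⟨p, q, he, rfl, rfl⟩ | ⟨p, q, he, rfl, rfl⟩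
  · exact (mul_one x).symm ▸ Set.mem_singleton_iff.1 hx ▸ one_mem_language
  · exact (mul_one x).symm ▸ Set.mem_singleton_iff.1 hx ▸ one_mem_language
  · exact Or.inl ((mul_one x).symm ▸ hx)
  · exact Or.inr ((mul_one x).symm ▸ hx)
  · rw [glue_two_mul_add_two] at hx ⊢
    exact mul_mem_language hx he
  · rw [glue_two_mul_add_three] at hx ⊢
    exact mul_mem_language hx he

theorem language_unionNfa : language (unionNfa E₁ E₂) 1 = language E₁ 1 ∪ language E₂ 1 := by
  refine Set.Subset.antisymm language_unionNfa_subset ?_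
  have hedge {e} (he : e ∈ [(0, 1, 2), (0, 1, 3), (4, 1, 1), (5, 1, 1)]) : e ∈ unionNfa E₁ E₂ :=
    List.mem_append_left _ he
  rintro x (hx | hx)
  · have hpath : Path (unionNfa E₁ E₂) 2 x 4 := Path.rename (i := (2 * · + 2)) hx fun e he =>
      List.mem_append_right _ (List.mem_append_left _ he)
    exact Path.of_silent_edges (hedge (by simp)) hpath (hedge (by simp))
  · have hpath : Path (unionNfa E₁ E₂) 3 x 5 := Path.rename (i := (2 * · + 3)) hx fun e he =>
      List.mem_append_right _ (List.mem_append_right _ he)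
    exact Path.of_silent_edges (hedge (by simp)) hpath (hedge (by simp))

theorem language_concatNfa_subset : language (concatNfa E₁ g E₂) q ⊆
    glue {1} (language E₁ 1 * {g} * language E₂ 1) (language E₁)
      (fun p => language E₁ 1 * {g} * language E₂ p) q := by
  refine language_subset_of_invariant rfl fun p h q he x hx => ?_
  simp only [concatNfa, List.mem_append, List.mem_cons, Prod.mk.injEq, List.not_mem_nil, or_false,
    mem_renameStates] at he
  rcases he with (⟨rfl, rfl, rfl⟩ | ⟨rfl, rfl, rfl⟩ | ⟨rfl, rfl, rfl⟩) |
    ⟨p, q, he, rfl, rfl⟩ | ⟨p, q, he, rfl, rfl⟩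
  · exact (mul_one x).symm ▸ Set.mem_singleton_iff.1 hx ▸ one_mem_language
  · exact ⟨x * h, Set.mul_mem_mul hx rfl, 1, one_mem_language, mul_one _⟩
  · exact (mul_one x).symm ▸ hx
  · rw [glue_two_mul_add_two] at hx ⊢
    exact mul_mem_language hx he
  · rw [glue_two_mul_add_three] at hx ⊢
    obtain ⟨y, hy, z, hz, rfl⟩ := hx
    exact ⟨y, hy, z * h, mul_mem_language hz he, (mul_assoc y z h).symm⟩

theorem language_concatNfa :
    language (concatNfa E₁ g E₂) 1 = language E₁ 1 * {g} * language E₂ 1 := by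
  refine Set.Subset.antisymm language_concatNfa_subset ?_
  have hedge {e} (he : e ∈ [(0, 1, 2), (4, g, 3), (5, 1, 1)]) : e ∈ concatNfa E₁ g E₂ :=
    List.mem_append_left _ he
  rintro _ ⟨_, ⟨y, hy, h, hg, rfl⟩, z, hz, rfl⟩
  obtain rfl : g = h := (Set.mem_singleton_iff.1 hg).symm
  have hpath₁ : Path (concatNfa E₁ g E₂) 2 y 4 := Path.rename (i := (2 * · + 2)) hy fun e he =>
    List.mem_append_right _ (List.mem_append_left _ he)
  have hpath₂ : Path (concatNfa E₁ g E₂) 3 z 5 := Path.rename (i := (2 * · + 3)) hz fun e he =>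
    List.mem_append_right _ (List.mem_append_right _ he)
  exact Path.of_silent_edges (hedge (by simp))
    ((hpath₁.trans (Path.single (hedge (by simp)))).trans hpath₂) (hedge (by simp))

theorem language_starNfa_subset : language (starNfa E) q ⊆
    glue (Submonoid.closure (language E 1)) (Submonoid.closure (language E 1))
      (fun p => Submonoid.closure (language E 1) * language E p)
      (fun _ => Submonoid.closure (language E 1)) q := by
  refine language_subset_of_invariant (one_mem (Submonoid.closure _)) fun p h q he x hx => ?_
  simp only [starNfa, List.mem_append, List.mem_cons, Prod.mk.injEq, List.not_mem_nil, or_false,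
    mem_renameStates] at he
  rcases he with (⟨rfl, rfl, rfl⟩ | ⟨rfl, rfl, rfl⟩ | ⟨rfl, rfl, rfl⟩ | ⟨rfl, rfl, rfl⟩) |
    ⟨p, q, he, rfl, rfl⟩
  · exact (mul_one x).symm ▸ hx
  · exact ⟨x, hx, 1, one_mem_language, rfl⟩
  · obtain ⟨y, hy, z, hz, rfl⟩ := hx
    exact (mul_one (y * z)).symm ▸ mul_mem hy (Submonoid.subset_closure hz)
  · exact (mul_one x).symm ▸ hx
  · rw [glue_two_mul_add_two] at hx ⊢
    obtain ⟨y, hy, z, hz, rfl⟩ := hx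
    exact ⟨y, hy, z * h, mul_mem_language hz he, (mul_assoc y z h).symm⟩

theorem language_starNfa : language (starNfa E) 1 = Submonoid.closure (language E 1) := by
  refine Set.Subset.antisymm language_starNfa_subset fun x hx => ?_
  have hedge {e} (he : e ∈ [(0, 1, 3), (3, 1, 2), (4, 1, 3), (3, 1, 1)]) : e ∈ starNfa E :=
    List.mem_append_left _ he
  have hloop : Path (starNfa E) 3 x 3 := by
    induction hx using Submonoid.closure_induction with
    | mem y hy =>
      have hpath : Path (starNfa E) 2 y 4 := Path.rename (i := (2 * · + 2)) hy fun e he =>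
        List.mem_append_right _ he
      exact Path.of_silent_edges (hedge (by simp)) hpath (hedge (by simp))
    | one => exact Path.nil 3
    | mul y z _ _ hy hz => exact hy.trans hz
  exact Path.of_silent_edges (hedge (by simp)) hloop (hedge (by simp))

variable {l : List ℕ} {E : ℕ → Automaton M} {a : ℕ}

theorem exists_mem_language_of_path_disjointUnion
    (h : Path (disjointUnion l E) (Nat.pair a 0) x q) :
    ∃ p, q = Nat.pair a p ∧ x ∈ language (E a) p := by
  have hinvariant := h.mem_of_invariant (x := 1)
    (Y := fun q => {x | ∃ p, q = Nat.pair a p ∧ x ∈ language (E a) p}) ?_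
    ⟨0, rfl, one_mem_language⟩
  · rwa [one_mul] at hinvariant
  · rintro _ g _ he x ⟨p, rfl, hx⟩
    obtain ⟨b, -, p', q, hg, hp, rfl⟩ := mem_disjointUnion.1 he
    obtain ⟨rfl, rfl⟩ := Nat.pair_eq_pair.1 hp
    exact ⟨q, rfl, mul_mem_language hx hg⟩

theorem path_disjointUnion_iff (ha : a ∈ l) :
    Path (disjointUnion l E) (Nat.pair a 0) x (Nat.pair a q) ↔ x ∈ language (E a) q := by
  refine ⟨fun h => ?_, fun h => Path.rename h fun e he => List.mem_flatMap.2 ⟨a, ha, he⟩⟩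
  obtain ⟨p, hp, hx⟩ := exists_mem_language_of_path_disjointUnion h
  obtain ⟨-, rfl⟩ := Nat.pair_eq_pair.1 hp
  exact hx

end Constructions

section PrimrecConstructions

variable {α M : Type*} [Primcodable α] [Primcodable M]

theorem primrec_renameStates {i : α → ℕ → ℕ} {E : α → Automaton M} (hi : Primrec₂ i)
    (hE : Primrec E) : Primrec fun a => renameStates (i a) (E a) := by
  have he : Primrec fun z : α × ℕ × M × ℕ => z.2 := Primrec.snd
  exact Primrec.list_map hE ((hi.comp Primrec.fst (Primrec.fst.comp he)).pair
    ((Primrec.fst.comp (Primrec.snd.comp he)).pair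
      (hi.comp Primrec.fst (Primrec.snd.comp (Primrec.snd.comp he)))))

theorem primrec_two_mul_add (c : ℕ) : Primrec₂ fun (_ : α) (p : ℕ) => 2 * p + c :=
  Primrec.nat_add.comp (Primrec.nat_mul.comp (Primrec.const 2) Primrec.snd) (Primrec.const c)

theorem primrec_mapLabels {M' : Type*} [Primcodable M'] {f : M → M'} {E : α → Automaton M}
    (hf : Primrec f) (hE : Primrec E) : Primrec fun a => mapLabels f (E a) := by
  have he : Primrec fun z : α × ℕ × M × ℕ => z.2 := Primrec.snd
  exact Primrec.list_map hE ((Primrec.fst.comp he).pair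
    ((hf.comp (Primrec.fst.comp (Primrec.snd.comp he))).pair
      (Primrec.snd.comp (Primrec.snd.comp he))))

theorem primrec_listNfa {l : α → List M} (hl : Primrec l) : Primrec fun a => listNfa (l a) :=
  Primrec.list_map hl ((Primrec.const 0).pair (Primrec.snd.pair (Primrec.const 1)))

theorem primrec_disjointUnion {l : α → List ℕ} {E : ℕ → Automaton M} (hl : Primrec l)
    (hE : Primrec E) : Primrec fun a => disjointUnion (l a) E :=
  Primrec.list_flatMap hl (primrec_renameStates
    (Primrec₂.natPair.comp (Primrec.snd.comp Primrec.fst) Primrec.snd) (hE.comp Primrec.snd))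

variable [Monoid M] {E E₁ E₂ : α → Automaton M}

theorem primrec_unionNfa (h₁ : Primrec E₁) (h₂ : Primrec E₂) :
    Primrec fun a => unionNfa (E₁ a) (E₂ a) :=
  Primrec.list_append.comp (Primrec.const _) (Primrec.list_append.comp
    (primrec_renameStates (primrec_two_mul_add 2) h₁)
    (primrec_renameStates (primrec_two_mul_add 3) h₂))

theorem primrec_concatNfa {g : α → M} (h₁ : Primrec E₁) (hg : Primrec g) (h₂ : Primrec E₂) :
    Primrec fun a => concatNfa (E₁ a) (g a) (E₂ a) :=
  Primrec.list_append.comp (Primrec.list_cons.comp (Primrec.const _) (Primrec.list_cons.comp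
    ((Primrec.const 4).pair (hg.pair (Primrec.const 3))) (Primrec.const _)))
    (Primrec.list_append.comp (primrec_renameStates (primrec_two_mul_add 2) h₁)
      (primrec_renameStates (primrec_two_mul_add 3) h₂))

theorem primrec_starNfa (h : Primrec E) : Primrec fun a => starNfa (E a) :=
  Primrec.list_append.comp (Primrec.const _)
    (primrec_renameStates (primrec_two_mul_add 2) h)

end PrimrecConstructions

section Translation

open scoped Pointwise

variable {M : Type*} [Monoid M] [Primcodable M]

/-- The automaton of the rational expression over `M` with the given code. -/
def ratNfa (M : Type*) [Monoid M] [Primcodable M] : ℕ → Automaton M :=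
  treeRec (fun m => listNfa ((Encodable.decode (α := List M) m).getD []))
    fun t _ E E₁ E₂ =>
      if t = 1 then unionNfa E₁ E₂ else if t = 2 then concatNfa E₁ 1 E₂ else starNfa E

theorem primrec_ratNfa : Primrec (ratNfa M) := by
  have hrec : Primrec₂ fun (_ : Unit) n => ratNfa M n := by
    refine primrec_treeRec (primrec_listNfa (Primrec.option_getD.comp
      (Primrec.decode.comp Primrec.snd) (Primrec.const []))) ?_
    let Args := Unit × (ℕ × ℕ) × Automaton M × Automaton M × Automaton M
    have label : Primrec fun z : Args => z.2.1.1 :=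
      Primrec.fst.comp (Primrec.fst.comp Primrec.snd)
    have values : Primrec fun z : Args => z.2.2 := Primrec.snd.comp Primrec.snd
    have first := Primrec.fst.comp (Primrec.snd.comp values)
    have second := Primrec.snd.comp (Primrec.snd.comp values)
    exact Primrec.ite (Primrec.eq.comp label (Primrec.const 1)) (primrec_unionNfa first second)
      (Primrec.ite (Primrec.eq.comp label (Primrec.const 2))
        (primrec_concatNfa first (Primrec.const 1) second)
        (primrec_starNfa (Primrec.fst.comp values)))
  exact hrec.comp (Primrec.const ()) Primrec.id

theorem encode_map_encode {α : Type*} [Encodable α] (l : List α) :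
    Encodable.encode (l.map (Encodable.encode : α → ℕ)) = Encodable.encode l := by
  induction l with
  | nil => rfl
  | cons a l ih => simp [ih]

theorem language_ratNfa (e : RatExpr M) : language (ratNfa M (e.code Encodable.encode)) 1 =
    e.eval := by
  induction e with
  | finite l =>
    rw [RatExpr.code, ratNfa, treeRec_leaf, language_listNfa, encode_map_encode,
      Encodable.encodek, Option.getD_some, RatExpr.eval]
  | union e₁ e₂ ih₁ ih₂ =>
    rw [RatExpr.code, ratNfa, treeRec_node _ _ 0, Nat.unpair_pair, if_pos rfl, language_unionNfa]
    exact congrArg₂ (· ∪ ·) ih₁ ih₂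
  | mul e₁ e₂ ih₁ ih₂ =>
    rw [RatExpr.code, ratNfa, treeRec_node _ _ 1, Nat.unpair_pair, if_neg (by decide),
      if_pos rfl, language_concatNfa, Set.singleton_one, mul_one]
    exact congrArg₂ (· * ·) ih₁ ih₂
  | star e ih =>
    rw [RatExpr.code, ratNfa, treeRec_node _ _ 2, if_neg (by decide), if_neg (by decide),
      language_starNfa]
    exact congrArg (fun L : Set M => (Submonoid.closure L : Set M)) ih

/-- The automaton of the formal product over `N` with the given code. -/
def flatNfa (N : Submonoid M) [Primcodable N] : ℕ → Automaton M :=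
  treeRec (fun m => mapLabels N.subtype (ratNfa N m)) fun _ m _ E _ =>
    concatNfa E ((Encodable.decode m.unpair.2.unpair.1).getD 1)
      (mapLabels N.subtype (ratNfa N m.unpair.2.unpair.2))

variable {N : Submonoid M} [Primcodable N]

theorem primrec_flatNfa (hN : ∀ h : N, Encodable.encode h = Encodable.encode (h : M)) :
    Primrec (flatNfa N) := by
  have hval : Primrec N.subtype := Primrec.encode_iff.1 (Primrec.encode.of_eq hN)
  have hrec : Primrec₂ fun (_ : Unit) n => flatNfa N n := by
    refine primrec_treeRec (primrec_mapLabels hval (primrec_ratNfa.comp Primrec.snd)) ?_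
    let Args := Unit × (ℕ × ℕ) × Automaton M × Automaton M × Automaton M
    have content : Primrec fun z : Args => z.2.1.2.unpair.2.unpair :=
      Primrec.unpair.comp (Primrec.snd.comp
        (Primrec.unpair.comp (Primrec.snd.comp (Primrec.fst.comp Primrec.snd))))
    have values : Primrec fun z : Args => z.2.2 := Primrec.snd.comp Primrec.snd
    exact primrec_concatNfa (Primrec.fst.comp (Primrec.snd.comp values))
      (Primrec.option_getD.comp (Primrec.decode.comp (Primrec.fst.comp content))
        (Primrec.const 1))
      (primrec_mapLabels hval (primrec_ratNfa.comp (Primrec.snd.comp content)))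
  exact hrec.comp (Primrec.const ()) Primrec.id

theorem language_flatNfa (hN : ∀ h : N, Encodable.encode h = Encodable.encode (h : M))
    (t : FlatTerm N) : language (flatNfa N (t.code Encodable.encode)) 1 = t.eval := by
  have hrat (e : RatExpr N) : language (mapLabels N.subtype
      (ratNfa N (e.code fun h : N => Encodable.encode (h : M)))) 1 = (↑) '' e.eval := by
    rw [language_mapLabels, ← funext hN, language_ratNfa]
    rfl
  induction t with
  | base e =>
    rw [FlatTerm.code, flatNfa, treeRec_leaf, hrat, FlatTerm.eval]
  | snoc p g e ih =>
    rw [FlatTerm.code, flatNfa, treeRec_node _ _ 0, language_concatNfa]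
    simp only [Nat.unpair_pair, Encodable.encodek, Option.getD_some, hrat]
    exact congrArg (fun L => L * {g} * _) ih

/-- The codes of the formal products in the Boolean expression with the given code. -/
def atoms : ℕ → List ℕ :=
  treeRec (fun m => (Encodable.decode (α := List ℕ) m).getD [])
    fun t _ l l₁ l₂ => if t = 3 then l else l₁ ++ l₂

theorem primrec_atoms : Primrec atoms := by
  have hrec : Primrec₂ fun (_ : Unit) n => atoms n := by
    refine primrec_treeRec (Primrec.option_getD.comp (Primrec.decode.comp Primrec.snd)
      (Primrec.const [])) ?_
    let Args := Unit × (ℕ × ℕ) × List ℕ × List ℕ × List ℕ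
    have label : Primrec fun z : Args => z.2.1.1 :=
      Primrec.fst.comp (Primrec.fst.comp Primrec.snd)
    have values : Primrec fun z : Args => z.2.2 := Primrec.snd.comp Primrec.snd
    exact Primrec.ite (Primrec.eq.comp label (Primrec.const 3)) (Primrec.fst.comp values)
      (Primrec.list_append.comp (Primrec.fst.comp (Primrec.snd.comp values))
        (Primrec.snd.comp (Primrec.snd.comp values)))
  exact hrec.comp (Primrec.const ()) Primrec.id

/-- The truth value of the Boolean expression with the given code at an element that belongs
exactly to those of its formal products whose codes are in `L`. -/
def truth (L : List ℕ) : ℕ → Bool :=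
  treeRec (fun m => decide (∃ a ∈ (Encodable.decode (α := List ℕ) m).getD [], a ∈ L))
    fun t _ x y z => if t = 1 then y || z else if t = 2 then y && z else !x

theorem primrec_truth : Primrec₂ truth := by
  refine primrec_treeRec ?_ ?_
  · exact PrimrecPred.decide (primrecPred_exists_mem (Primrec.option_getD.comp
      (Primrec.decode.comp Primrec.snd) (Primrec.const []))
      (primrecPred_mem (Primrec.fst.comp Primrec.fst) Primrec.snd))
  · let Args := List ℕ × (ℕ × ℕ) × Bool × Bool × Bool
    have label : Primrec fun z : Args => z.2.1.1 :=
      Primrec.fst.comp (Primrec.fst.comp Primrec.snd)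
    have values : Primrec fun z : Args => z.2.2 := Primrec.snd.comp Primrec.snd
    have first := Primrec.fst.comp (Primrec.snd.comp values)
    have second := Primrec.snd.comp (Primrec.snd.comp values)
    exact Primrec.ite (Primrec.eq.comp label (Primrec.const 1)) (Primrec.or.comp first second)
      (Primrec.ite (Primrec.eq.comp label (Primrec.const 2)) (Primrec.and.comp first second)
        (Primrec.not.comp (Primrec.fst.comp values)))

theorem truth_code_iff {M : Type*} [Monoid M] {N : Submonoid M} {c : M → ℕ} {D : ℕ → Set M}
    (hD : ∀ t : FlatTerm N, D (t.code c) = t.eval) (b : BoolExpr N) {x : M} {L : List ℕ}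
    (hL : ∀ a ∈ atoms (b.code c), a ∈ L ↔ x ∈ D a) : truth L (b.code c) = true ↔ x ∈ b.eval := by
  induction b with
  | flat l =>
    rw [BoolExpr.code, atoms, treeRec_leaf, Encodable.encodek, Option.getD_some] at hL
    rw [BoolExpr.code, truth, treeRec_leaf, Encodable.encodek, decide_eq_true_iff,
      Option.getD_some, exists_congr fun a => and_congr_right (hL a)]
    simp only [List.mem_map, BoolExpr.eval, Set.mem_ofPred_eq, ← hD]
    exact ⟨fun ⟨_, ⟨t, ht, ha⟩, hx⟩ => ⟨t, ht, ha ▸ hx⟩, fun ⟨t, ht, hx⟩ => ⟨_, ⟨t, ht, rfl⟩, hx⟩⟩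
  | union b₁ b₂ ih₁ ih₂ =>
    rw [BoolExpr.code, atoms, treeRec_node _ _ 0, if_neg (by decide), Nat.unpair_pair] at hL
    rw [BoolExpr.code, truth, treeRec_node _ _ 0, if_pos rfl, Nat.unpair_pair, Bool.or_eq_true]
    exact or_congr (ih₁ fun a ha => hL a (List.mem_append_left _ ha))
      (ih₂ fun a ha => hL a (List.mem_append_right _ ha))
  | inter b₁ b₂ ih₁ ih₂ =>
    rw [BoolExpr.code, atoms, treeRec_node _ _ 1, if_neg (by decide), Nat.unpair_pair] at hL
    rw [BoolExpr.code, truth, treeRec_node _ _ 1, if_neg (by decide), if_pos rfl,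
      Nat.unpair_pair, Bool.and_eq_true]
    exact and_congr (ih₁ fun a ha => hL a (List.mem_append_left _ ha))
      (ih₂ fun a ha => hL a (List.mem_append_right _ ha))
  | compl b ih =>
    rw [BoolExpr.code, atoms, treeRec_node _ _ 2, if_pos rfl] at hL
    rw [BoolExpr.code, truth, treeRec_node _ _ 2, if_neg (by decide), if_neg (by decide),
      Bool.not_eq_true', ← Bool.not_eq_true]
    exact not_congr (ih hL)

end Translation

section Cosets

open scoped Pointwise

variable {G : Type*} [Group G] {H : Subgroup G}

theorem IsCosetFinite.language_concatNfa {E₁ E₂ : Automaton G}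
    (h₁ : IsCosetFinite H (⋃ q, language E₁ q))
    (h₂ : ∀ g, IsCosetFinite H ({g} * ⋃ q, language E₂ q)) (g : G) :
    IsCosetFinite H (⋃ q, language (concatNfa E₁ g E₂) q) := by
  let Y := ⋃ q, language E₁ q
  let Z := ⋃ q, language E₂ q
  have hproduct : IsCosetFinite H (Y * {g} * Z) := by
    rw [mul_assoc]
    exact h₁.mul fun k => by simpa only [← mul_assoc, Set.singleton_mul_singleton] using h₂ (k * g)
  have hsubset (p : ℕ) : language E₁ 1 * {g} * language E₂ p ⊆ Y * {g} * Z :=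
    Set.mul_subset_mul (Set.mul_subset_mul_right (Set.subset_iUnion _ _)) (Set.subset_iUnion _ _)
  refine (h₁.union hproduct).mono (Set.iUnion_subset fun q => language_concatNfa_subset.trans
    (glue_subset ?_ ?_ (fun p => ?_) fun p => ?_))
  · exact Set.singleton_subset_iff.2 (Or.inl (Set.mem_iUnion.2 ⟨0, one_mem_language⟩))
  · exact (hsubset 1).trans Set.subset_union_right
  · exact (Set.subset_iUnion _ p).trans Set.subset_union_left
  · exact (hsubset p).trans Set.subset_union_right

theorem isCosetFinite_language_flatNfa [Primcodable G] {N : Submonoid G} [Primcodable N]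
    (hN : ∀ g, IsCosetFinite H ({g} * (N : Set G))) (n : ℕ) :
    IsCosetFinite H (⋃ q, language (flatNfa N n) q) := by
  have hrat (m : ℕ) : ⋃ q, language (mapLabels N.subtype (ratNfa N m)) q ⊆ N := by
    simp only [language_mapLabels, Set.iUnion_subset_iff, Set.image_subset_iff]
    exact fun _ x _ => x.2
  refine treeRec_induction (P := fun _ E => IsCosetFinite H (⋃ q, language E q)) (fun m => ?_)
    (fun _ m _ _ _ _ hE _ => hE.language_concatNfa (fun g => ?_) _) n
  · have hone := hN 1
    rw [Set.singleton_one, one_mul] at hone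
    exact hone.mono (hrat m)
  · exact (hN g).mono (Set.mul_subset_mul_left (hrat _))

end Cosets

section BooleanCombinations

variable {M : Type*} [Monoid M] {N : Submonoid M}

theorem isRational_iff_exists_eval (L : Set M) : IsRational L ↔ ∃ e : RatExpr M, e.eval = L := by
  constructor
  · intro h
    induction h with
    | finite L hL =>
      obtain ⟨s, rfl⟩ := hL.exists_finset_coe
      exact ⟨.finite s.toList, Set.ext fun x => Finset.mem_toList⟩
    | union L₁ L₂ _ _ ih₁ ih₂ =>
      obtain ⟨⟨e₁, rfl⟩, e₂, rfl⟩ := And.intro ih₁ ih₂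
      exact ⟨.union e₁ e₂, rfl⟩
    | mul L₁ L₂ _ _ ih₁ ih₂ =>
      obtain ⟨⟨e₁, rfl⟩, e₂, rfl⟩ := And.intro ih₁ ih₂
      exact ⟨.mul e₁ e₂, rfl⟩
    | star L _ ih =>
      obtain ⟨e, rfl⟩ := ih
      exact ⟨.star e, rfl⟩
  · rintro ⟨e, rfl⟩
    induction e with
    | finite l => exact .finite _ (List.finite_toSet l)
    | union e₁ e₂ ih₁ ih₂ => exact .union _ _ ih₁ ih₂
    | mul e₁ e₂ ih₁ ih₂ => exact .mul _ _ ih₁ ih₂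
    | star e ih => exact .star _ ih

theorem isFlatProduct_iff_exists_eval (P : Set M) :
    IsFlatProduct N P ↔ ∃ t : FlatTerm N, t.eval = P := by
  constructor
  · intro h
    induction h with
    | base L hL =>
      obtain ⟨e, rfl⟩ := (isRational_iff_exists_eval L).1 hL
      exact ⟨.base e, rfl⟩
    | snoc P g L _ hL ih =>
      obtain ⟨t, rfl⟩ := ih
      obtain ⟨e, rfl⟩ := (isRational_iff_exists_eval L).1 hL
      exact ⟨.snoc t g e, rfl⟩
  · rintro ⟨t, rfl⟩
    induction t with
    | base e => exact .base _ ((isRational_iff_exists_eval _).2 ⟨e, rfl⟩)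
    | snoc p g e ih => exact .snoc _ g _ ih ((isRational_iff_exists_eval _).2 ⟨e, rfl⟩)

theorem eval_flat_eq_sUnion (l : List (FlatTerm N)) :
    (BoolExpr.flat l).eval = ⋃₀ (FlatTerm.eval '' {t | t ∈ l}) := by
  ext x
  simp [BoolExpr.eval]

theorem isFlatRational_iff_exists_eval (L : Set M) :
    IsFlatRational N L ↔ ∃ l : List (FlatTerm N), (BoolExpr.flat l).eval = L := by
  simp only [eval_flat_eq_sUnion]
  constructor
  · rintro ⟨S, hS, hP, rfl⟩
    have : Nonempty (FlatTerm N) := ⟨.base (.finite [])⟩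
    choose! t ht using fun P hPS => (isFlatProduct_iff_exists_eval P).1 (hP P hPS)
    refine ⟨hS.toFinset.toList.map t, congrArg Set.sUnion ?_⟩
    calc FlatTerm.eval '' {u | u ∈ hS.toFinset.toList.map t}
        = (fun P => (t P).eval) '' S := by ext; simp
      _ = S := (Set.image_congr ht).trans (Set.image_id' S)
  · rintro ⟨l, rfl⟩
    refine ⟨_, (List.finite_toSet l).image _, ?_, rfl⟩
    rintro _ ⟨t, -, rfl⟩
    exact (isFlatProduct_iff_exists_eval _).2 ⟨t, rfl⟩

theorem mem_closure_isFlatRational_iff (B : Set M) :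
    B ∈ BooleanSubalgebra.closure {L | IsFlatRational N L} ↔ ∃ b : BoolExpr N, b.eval = B := by
  constructor
  · intro h
    induction h using BooleanSubalgebra.closure_bot_sup_induction with
    | mem L hL =>
      obtain ⟨l, rfl⟩ := (isFlatRational_iff_exists_eval L).1 hL
      exact ⟨.flat l, rfl⟩
    | bot => exact ⟨.flat [], by simp [eval_flat_eq_sUnion]⟩
    | sup L₁ _ L₂ _ ih₁ ih₂ =>
      obtain ⟨⟨b₁, rfl⟩, b₂, rfl⟩ := And.intro ih₁ ih₂
      exact ⟨.union b₁ b₂, rfl⟩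
    | compl L _ ih =>
      obtain ⟨b, rfl⟩ := ih
      exact ⟨.compl b, rfl⟩
  · rintro ⟨b, rfl⟩
    induction b with
    | flat l =>
      exact BooleanSubalgebra.subset_closure ((isFlatRational_iff_exists_eval _).2 ⟨l, rfl⟩)
    | union b₁ b₂ ih₁ ih₂ => exact BooleanSubalgebra.sup_mem ih₁ ih₂
    | inter b₁ b₂ ih₁ ih₂ => exact BooleanSubalgebra.inf_mem ih₁ ih₂
    | compl b ih => exact BooleanSubalgebra.compl_mem ih

end BooleanCombinations

section Decision

open scoped Pointwise

theorem exists_computable_eval_eq_empty {G : Type*} [Group G] [Primcodable G] {ι : Type*}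
    [Finite ι] (hmul : Primrec₂ fun g h : G => g * h) (hinv : Primrec fun g : G => g⁻¹)
    {φ : FreeGroup ι →* G} (hφ : Function.Injective φ) (hH : PrimrecPred (· ∈ φ.range))
    (hindex : φ.range.index = 0) {N : Submonoid G} (hN : PrimrecPred (· ∈ N))
    (hcover : ∀ g, IsCosetFinite φ.range ({g} * (N : Set G))) :
    ∃ f : ℕ → Bool, Computable f ∧
      ∀ b : BoolExpr N, f (b.code Encodable.encode) = true ↔ b.eval = ∅ := by
  classical
  let := Primcodable.subtype hN
  have hcode (h : N) : Encodable.encode h = Encodable.encode (h : G) := rfl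
  have hfin (n : ℕ) : IsCosetFinite φ.range {x | ∃ a ∈ atoms n, ∃ q,
      Path (disjointUnion (atoms n) (flatNfa N)) (Nat.pair a 0) x q} := by
    refine (isCosetFinite_biUnion (List.finite_toSet (atoms n)) fun a _ =>
      isCosetFinite_language_flatNfa hcover a).mono ?_
    rintro x ⟨a, ha, q, hx⟩
    obtain ⟨p, -, hx⟩ := exists_mem_language_of_path_disjointUnion hx
    exact Set.mem_biUnion ha (Set.mem_iUnion.2 ⟨p, hx⟩)
  obtain ⟨f, hf, hsat⟩ := exists_computable_satisfiable (P := fun n L => truth L n = true)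
    hmul hinv hφ hH (not_isCosetFinite_univ hindex)
    (primrec_disjointUnion primrec_atoms (primrec_flatNfa hcode)) primrec_atoms
    (Primrec.eq.comp (primrec_truth.comp Primrec.snd Primrec.fst) (Primrec.const true))
    (fun _ _ _ _ => unpair_fst_eq_of_mem_disjointUnion) hfin
  refine ⟨fun n => !f n, Primrec.not.to_comp.comp hf, fun b => ?_⟩
  rw [Bool.not_eq_true', ← Bool.not_eq_true, hsat, Set.eq_empty_iff_forall_notMem, not_exists]
  refine forall_congr' fun x => not_congr (truth_code_iff
    (D := fun a => language (flatNfa N a) 1) (language_flatNfa hcode) b fun a ha => ?_)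
  rw [List.mem_filter, decide_eq_true_iff, path_disjointUnion_iff ha]
  exact and_iff_right ha

end Decision

end FlatRational

open scoped Pointwise in
theorem mainTheorem2_general {G : Type*} [Group G] [Primcodable G] {ι : Type*} [Finite ι]
    (hmul : Primrec₂ fun g h : G => g * h) (hinv : Primrec fun g : G => g⁻¹)
    {φ : FreeGroup ι →* G} (hφ : Function.Injective φ) (hH : PrimrecPred (· ∈ φ.range))
    (hindex : φ.range.index = 0) {N : Submonoid G} (hN : PrimrecPred (· ∈ N))
    (hcover : ∀ g, FlatRational.IsCosetFinite φ.range ({g} * (N : Set G))) :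
    (∀ B : Set G,
      B ∈ BooleanSubalgebra.closure {L | FlatRational.IsFlatRational N L} ↔
        ∃ b : FlatRational.BoolExpr N, b.eval = B) ∧
    ∃ f : ℕ → Bool, Computable f ∧
      ∀ b : FlatRational.BoolExpr N, f (b.code Encodable.encode) = true ↔ b.eval = ∅ :=
  ⟨FlatRational.mem_closure_isFlatRational_iff,
    FlatRational.exists_computable_eval_eq_empty hmul hinv hφ hH hindex hN hcover⟩

/-- The finite Boolean combinations of flat rational subsets of `GL(2,ℚ)` over `GL(2,ℤ)` are
exactly the sets described by Boolean expressions, and there is an algorithm that decides, on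
input of (the code of) such an expression, whether the set that it describes is empty. -/
theorem mainTheorem2 :
    (∀ B : Set (GL (Fin 2) ℚ),
      B ∈ BooleanSubalgebra.closure {L | FlatRational.IsFlatRational FlatRational.GL2Z L} ↔
        ∃ b : FlatRational.BoolExpr FlatRational.GL2Z, b.eval = B) ∧
    ∃ f : ℕ → Bool, Computable f ∧
      ∀ b : FlatRational.BoolExpr FlatRational.GL2Z,
        f (b.code FlatRational.matCode) = true ↔ b.eval = ∅ := by
  let := FlatRational.glPrimcodable
  exact mainTheorem2_general FlatRational.primrec_gl_mul FlatRational.primrec_gl_inv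
    FlatRational.sanov_injective
    (FlatRational.primrecPred_isSanov.of_eq fun g => (FlatRational.mem_range_sanov_iff g).symm)
    FlatRational.index_range_sanov FlatRational.primrecPred_mem_GL2Z
    FlatRational.isCosetFinite_singleton_mul_GL2Z
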